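/- Let $\mathbf H^3=\mathbb C\times(0,\infty)$ be hyperbolic $3$-space, $I$ its full isometry group, and $\mathbf S=\mathbb C\cup\{\infty\}$ its ideal boundary, on which $I$ acts by continuous extension. A *nice lattice* is a subgroup $\Gamma\subset I$ acting freely, properly discontinuously and cocompactly on $\mathbf H^3$ (so that $\mathbf H^3/\Gamma$ is a compact hyperbolic manifold). An *equivariant pair* $(H,h)$ consists of a bi-Lipschitz bijection $H:\mathbf H^3\to\mathbf H^3$ and a homeomorphism $h:\mathbf S\to\mathbf S$ extending $H$ continuously, such that for some nice lattices $\Gamma_1,\Gamma_2$ both $H\Gamma_1H^{-1}=\Gamma_2$ and $h\Gamma_1h^{-1}=\Gamma_2$. Write $(H,h)\sim(H',h')$ if there are $f,g\in I$ with $H'=fHg$ and $h'=fhg$. Pairs are normalized so that $h(\infty)=\infty$; then $h$ is also regarded as a homeomorphism of $\mathbb C$. For $z\in\mathbb C$ the *zoom sequence* based on $(h,z)$ is $(H_n,h_n)=(f_nHg_n,\,f_nhg_n)$, $n\ge 1$, where $f_n$ is the homothety fixing $h(z)$ with factor $n$ and $g_n$ is the homothety fixing $z$ with factor $1/n$. Write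 $h\to h'$ (with $H,H'$ understood) if for some $z\in\mathbb C$ the zoom sequence based on $(h,z)$ is tame, i.e. $\{H_n(p)\}$ is bounded for each $p\in\mathbf H^3$, and on a subsequence $H_n\to H'$ uniformly on compact subsets of $\mathbf H^3$ and $h_n\to h'$ uniformly on $\mathbf S$. A line $L\subset\mathbb C$ is *good* for $h$ if $h|_L$ is affine, i.e. $h(L)$ is a line and $h$ scales lengths on $L$ by a constant positive factor. **Corollary.** Let $(H,h)$ be an equivariant pair with $h(\infty)=\infty$, and let $D$ be a direction in $\mathbb C$. Then there are equivariant pairs $(H',h')$ and $(H'',h'')$, with $h'(\infty)=h''(\infty)=\infty$ and both equivalent ($\sim$) to $(H,h)$, such that $h\to h'\to h''$ and every line in $\mathbb C$ of direction $D$ is good for $h''$. -/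

import Mathlib

open Set Filter Topology

/-- Points `(z, t)`, `t > 0`, of the upper half space model of hyperbolic 3-space. -/
@[ext]
structure HypThree where
  z : ℂ
  t : ℝ
  pos : 0 < t

namespace HypThree

/-- The point as a point of the Euclidean space `ℂ × ℝ` (with the Euclidean norm). -/
def toEuclid (p : HypThree) : WithLp 2 (ℂ × ℝ) := WithLp.toLp 2 (p.z, p.t)

/-- The Euclidean reflection `(z, -t)` of the point. -/
def toEuclidRefl (p : HypThree) : WithLp 2 (ℂ × ℝ) := WithLp.toLp 2 (p.z, -p.t)

/-- The hyperbolic distance (curvature `-1`):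
`sinh (d / 2) = |p - q| / (2 √(t_p t_q))`, with `|p - q|` the Euclidean distance. -/
noncomputable instance : Dist HypThree :=
  ⟨fun p q => 2 * Real.arsinh (dist p.toEuclid q.toEuclid / (2 * √(p.t * q.t)))⟩

theorem dist_def (p q : HypThree) :
    dist p q = 2 * Real.arsinh (dist p.toEuclid q.toEuclid / (2 * √(p.t * q.t))) := rfl

theorem sq_dist_toEuclid (p q : HypThree) :
    dist p.toEuclid q.toEuclid ^ 2 = ‖p.z - q.z‖ ^ 2 + (p.t - q.t) ^ 2 := by
  rw [dist_eq_norm, WithLp.prod_norm_sq_eq_of_L2]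
  simp [toEuclid]

theorem sq_dist_toEuclidRefl (p q : HypThree) :
    dist p.toEuclid q.toEuclidRefl ^ 2 = ‖p.z - q.z‖ ^ 2 + (p.t + q.t) ^ 2 := by
  rw [dist_eq_norm, WithLp.prod_norm_sq_eq_of_L2]
  simp [toEuclid, toEuclidRefl]

theorem sinh_half_dist (p q : HypThree) :
    Real.sinh (dist p q / 2) = dist p.toEuclid q.toEuclid / (2 * √(p.t * q.t)) := by
  rw [dist_def, mul_div_cancel_left₀ _ (two_ne_zero' ℝ), Real.sinh_arsinh]

theorem cosh_half_dist (p q : HypThree) :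
    Real.cosh (dist p q / 2) = dist p.toEuclid q.toEuclidRefl / (2 * √(p.t * q.t)) := by
  have hp := p.pos
  have hq := q.pos
  have h0 : 0 < p.t * q.t := mul_pos hp hq
  rw [← sq_eq_sq₀ (Real.cosh_pos _).le (by positivity), Real.cosh_sq, sinh_half_dist, div_pow,
    div_pow, sq_dist_toEuclid, sq_dist_toEuclidRefl, mul_pow, Real.sq_sqrt h0.le]
  field_simp
  ring

theorem dist_refl_comm (p q : HypThree) :
    dist p.toEuclid q.toEuclidRefl = dist q.toEuclid p.toEuclidRefl := by
  rw [← sq_eq_sq₀ dist_nonneg dist_nonneg, sq_dist_toEuclidRefl, sq_dist_toEuclidRefl,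
    norm_sub_rev, add_comm p.t]

theorem dist_self_refl (p : HypThree) : dist p.toEuclid p.toEuclidRefl = 2 * p.t := by
  have hp := p.pos
  rw [← sq_eq_sq₀ dist_nonneg (by positivity), sq_dist_toEuclidRefl]
  simp
  ring

theorem dist_triangle' (a b c : HypThree) : dist a c ≤ dist a b + dist b c := by
  have ha := a.pos
  have hb := b.pos
  have hc := c.pos
  rw [← div_le_div_iff_of_pos_right (zero_lt_two' ℝ), ← Real.sinh_le_sinh, add_div,
    Real.sinh_add, sinh_half_dist, sinh_half_dist, sinh_half_dist, cosh_half_dist,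
    cosh_half_dist, dist_refl_comm b c]
  have key := EuclideanGeometry.mul_dist_le_mul_dist_add_mul_dist
    a.toEuclid b.toEuclid c.toEuclid b.toEuclidRefl
  rw [dist_self_refl] at key
  rw [Real.sqrt_mul ha.le, Real.sqrt_mul ha.le, Real.sqrt_mul hb.le]
  have h1 := Real.sqrt_pos.2 ha
  have h2 := Real.sqrt_pos.2 hb
  have h3 := Real.sqrt_pos.2 hc
  have h4 : √b.t ^ 2 = b.t := Real.sq_sqrt hb.le
  have e : dist a.toEuclid b.toEuclid / (2 * (√a.t * √b.t)) *
        (dist c.toEuclid b.toEuclidRefl / (2 * (√b.t * √c.t))) +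
      dist a.toEuclid b.toEuclidRefl / (2 * (√a.t * √b.t)) *
        (dist b.toEuclid c.toEuclid / (2 * (√b.t * √c.t))) =
      (dist a.toEuclid b.toEuclid * dist c.toEuclid b.toEuclidRefl +
        dist b.toEuclid c.toEuclid * dist a.toEuclid b.toEuclidRefl) /
        (4 * (√a.t * √c.t) * b.t) := by
    have h6 : 4 * (√a.t * √c.t) * b.t = 4 * (√a.t * √c.t) * √b.t ^ 2 := by rw [h4]
    rw [h6]
    field_simp
    ring
  rw [e, div_le_div_iff₀ (by positivity) (by positivity)]
  have h5 : 0 < 2 * (√a.t * √c.t) := by positivity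
  nlinarith [mul_le_mul_of_nonneg_right key h5.le]

theorem eq_of_dist_eq_zero' {p q : HypThree} (h : dist p q = 0) : p = q := by
  have hp := p.pos
  have hq := q.pos
  have h1 := sinh_half_dist p q
  rw [h, zero_div, Real.sinh_zero, eq_comm, div_eq_zero_iff] at h1
  have h2 : 0 < 2 * √(p.t * q.t) := by positivity
  have h3 : p.toEuclid = q.toEuclid := dist_eq_zero.1 (h1.resolve_right h2.ne')
  have h4 : (p.z, p.t) = (q.z, q.t) := WithLp.toLp_injective 2 h3
  exact HypThree.ext (congrArg Prod.fst h4) (congrArg Prod.snd h4)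

noncomputable instance : MetricSpace HypThree where
  dist_self p := by simp [dist_def]
  dist_comm p q := by rw [dist_def, dist_def, dist_comm p.toEuclid, mul_comm p.t]
  dist_triangle := dist_triangle'
  eq_of_dist_eq_zero := eq_of_dist_eq_zero'

/-- The homothety with centre `c ∈ ℂ` and factor `r > 0`, acting on hyperbolic space. -/
noncomputable def homothety (c : ℂ) (r : ℝ) (hr : 0 < r) (p : HypThree) : HypThree :=
  ⟨AffineMap.homothety c r p.z, r * p.t, mul_pos hr p.pos⟩

/-- Hyperbolic space inside the one-point compactification of `ℂ × ℝ`. -/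
def toBall (p : HypThree) : OnePoint (ℂ × ℝ) := ((p.z, p.t) : ℂ × ℝ)

end HypThree

/-- The Riemann sphere `ℂ ∪ {∞}`. -/
abbrev RSphere : Type := OnePoint ℂ

/-- The Riemann sphere as the ideal boundary of the upper half space, inside the one-point
compactification of `ℂ × ℝ`. -/
def RSphere.toBall : RSphere → OnePoint (ℂ × ℝ) := OnePoint.map fun z => (z, 0)

/-- The homeomorphism `h` of the sphere is the continuous extension of the map `H` of hyperbolic
space: whenever `p` tends to the ideal point `ξ`, `H p` tends to `h ξ`. -/
def IsBoundaryExtension (H : HypThree → HypThree) (h : RSphere ≃ₜ RSphere) : Prop :=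
  ∀ ξ : RSphere, Tendsto (fun p => (H p).toBall) (comap HypThree.toBall (𝓝 ξ.toBall))
    (𝓝 (h ξ).toBall)

/-- Bi-Lipschitz bijections of hyperbolic space. -/
def IsBL (H : Equiv.Perm HypThree) : Prop :=
  ∃ K : ℝ, 1 ≤ K ∧ ∀ p q, K⁻¹ * dist p q ≤ dist (H p) (H q) ∧ dist (H p) (H q) ≤ K * dist p q

/-- Nice lattices: groups of isometries of hyperbolic space that act freely, properly
discontinuously and cocompactly, i.e. the deck groups of compact hyperbolic 3-manifolds. -/
structure IsNiceLattice (Γ : Subgroup (HypThree ≃ᵢ HypThree)) : Prop where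
  free : ∀ g ∈ Γ, ∀ p, g p = p → g = 1
  discontinuous : ∀ K : Set HypThree, IsCompact K → {g | g ∈ Γ ∧ (g '' K ∩ K).Nonempty}.Finite
  cocompact : ∃ K : Set HypThree, IsCompact K ∧ ∀ p, ∃ g ∈ Γ, g p ∈ K

/-- The group `Γ` acting on the sphere: the set of boundary extensions of its elements. -/
def boundaryAction (Γ : Subgroup (HypThree ≃ᵢ HypThree)) : Set (RSphere ≃ₜ RSphere) :=
  {φ | ∃ g ∈ Γ, IsBoundaryExtension g φ}

/-- `(H, h)` is an equivariant pair: `H` is bi-Lipschitz, `h` is its continuous extension to the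
sphere, and `H Γ₁ H⁻¹ = Γ₂`, `h Γ₁ h⁻¹ = Γ₂` for one and the same pair of nice lattices. -/
def IsEquivariantPair (H : Equiv.Perm HypThree) (h : RSphere ≃ₜ RSphere) : Prop :=
  IsBL H ∧ IsBoundaryExtension H h ∧
    ∃ Γ₁ Γ₂ : Subgroup (HypThree ≃ᵢ HypThree), IsNiceLattice Γ₁ ∧ IsNiceLattice Γ₂ ∧
      (fun g : HypThree ≃ᵢ HypThree => H * g.toEquiv * H⁻¹) '' (Γ₁ : Set (HypThree ≃ᵢ HypThree))
        = IsometryEquiv.toEquiv '' (Γ₂ : Set (HypThree ≃ᵢ HypThree)) ∧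
      (fun φ : RSphere ≃ₜ RSphere => h * φ * h⁻¹) '' boundaryAction Γ₁ = boundaryAction Γ₂

/-- `(H, h) ∼ (H', h')`: there are isometries `f`, `g` with `H' = f H g` and `h' = f h g`, where
in the second equation `f`, `g` act on the sphere. -/
def PairEquivalent (H : Equiv.Perm HypThree) (h : RSphere ≃ₜ RSphere)
    (H' : Equiv.Perm HypThree) (h' : RSphere ≃ₜ RSphere) : Prop :=
  ∃ (f g : HypThree ≃ᵢ HypThree) (φ ψ : RSphere ≃ₜ RSphere),
    IsBoundaryExtension f φ ∧ IsBoundaryExtension g ψ ∧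
      (∀ p, H' p = f (H (g p))) ∧ ∀ ξ, h' ξ = φ (h (ψ ξ))

/-- The maps `f_m H g_m`, `m = n + 1 ≥ 1`, of the zoom sequence based on `(h, z)`: `f_m` is the
homothety fixing `h z` with factor `m`, and `g_m` the homothety fixing `z` with factor `1 / m`. -/
noncomputable def zoomHyp (H : Equiv.Perm HypThree) (h : ℂ ≃ₜ ℂ) (z : ℂ) (n : ℕ)
    (p : HypThree) : HypThree :=
  HypThree.homothety (h z) (n + 1) n.cast_add_one_pos
    (H (HypThree.homothety z (1 / (n + 1)) (one_div_pos.2 n.cast_add_one_pos) p))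

/-- The maps `f_m h g_m`, `m = n + 1 ≥ 1`, of the zoom sequence based on `(h, z)`, on `ℂ`. -/
noncomputable def zoomPlane (h : ℂ ≃ₜ ℂ) (z : ℂ) (n : ℕ) (u : ℂ) : ℂ :=
  AffineMap.homothety (h z) ((n : ℝ) + 1) (h (AffineMap.homothety z (1 / ((n : ℝ) + 1)) u))

/-- A sequence of maps of hyperbolic space is tame if the images of each point are bounded. -/
def IsTame (F : ℕ → HypThree → HypThree) : Prop :=
  ∀ p, Bornology.IsBounded (range fun n => F n p)

/-- Uniform convergence on the sphere, for its unique compatible uniform structure. -/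
def SphereTendstoUniformly (F : ℕ → RSphere → RSphere) (f : RSphere → RSphere) : Prop :=
  letI : UniformSpace RSphere := uniformSpaceOfCompactR1
  TendstoUniformly F f atTop

/-- `h → h'` (with `H`, `H'` in the background): for some base point `z`, the zoom sequence
`(H_n, h_n)` based on `(h, z)` is tame, and on a subsequence `H_n` converges to `H'` uniformly on
compact sets and `h_n` converges to `h'` uniformly on the sphere.  The homeomorphisms `h`, `h'` of
`ℂ` stand for homeomorphisms of the sphere that fix `∞`. -/
def ZoomsTo (H : Equiv.Perm HypThree) (h : ℂ ≃ₜ ℂ) (H' : Equiv.Perm HypThree) (h' : ℂ ≃ₜ ℂ) :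
    Prop :=
  ∃ z : ℂ, IsTame (zoomHyp H h z) ∧ ∃ s : ℕ → ℕ, StrictMono s ∧
    (∀ K : Set HypThree, IsCompact K →
      TendstoUniformlyOn (fun k => zoomHyp H h z (s k)) H' atTop K) ∧
    SphereTendstoUniformly (fun k => OnePoint.map (zoomPlane h z (s k))) h'.onePointCongr

/-- The line through `p` with direction `v`. -/
def planeLine (p v : ℂ) : Set ℂ := {x | ∃ s : ℝ, x = p + s * v}

/-- Straight lines in `ℂ`. -/
def IsPlaneLine (L : Set ℂ) : Prop := ∃ p v : ℂ, v ≠ 0 ∧ L = planeLine p v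

/-- The set `L` (a line) is good for `h`: `h` restricts to an affine map on `L`, i.e. `h(L)` is a
line and `h` scales lengths on `L` by a constant factor. -/
def IsGoodLine (h : ℂ → ℂ) (L : Set ℂ) : Prop :=
  IsPlaneLine (h '' L) ∧ ∃ c : ℝ, 0 < c ∧ ∀ x ∈ L, ∀ y ∈ L, dist (h x) (h y) = c * dist x y

/-- The direction of `v ≠ 0` is good for `h`: every line of this direction is good for `h`. -/
def IsGoodDirection (h : ℂ → ℂ) (v : ℂ) : Prop := ∀ p : ℂ, IsGoodLine h (planeLine p v)

/-!
In the hyperboloid model isometries of `HypThree` are restrictions of linear maps, which also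
describe their continuous extensions to the sphere. If `(H, h)` is an equivariant pair and `a n` is
any sequence of isometries, cocompactness of the lattices allows us to correct `a n` on both sides
of `H` by lattice elements until it stays bounded; hence every tame zoom sequence subconverges, and
its limits are equivalent to `(H, h)`. The same compactness, applied to cross ratios, shows that `h`
is quasisymmetric on `ℂ`. By the length-area method, `h` then has a nonzero derivative `w z` in the
direction `v` at each point `z` of a set of positive measure. At a point `z` of approximate
continuity of `w`, the zooms of `h` map every segment of direction `v` more and more accurately to a
segment of direction `w z`. So in the limit they are affine, with the same derivative, on all lines
of direction `v`. Zooming the limit once more gives the second pair.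
-/

/-! ### The hyperboloid model -/

/-- Minkowski space `ℝ^{1,3}`, with `(a, z, c)` standing for the Hermitian matrix with diagonal
entries `a`, `c` and off-diagonal entries `z`, `conj z`. -/
abbrev Mink : Type := ℝ × ℂ × ℝ

/-- The Lorentz form on Minkowski space, the polarized determinant of Hermitian matrices. -/
noncomputable def lorentzForm : LinearMap.BilinForm ℝ Mink :=
  LinearMap.mk₂ ℝ (fun x y => (x.1 * y.2.2 + x.2.2 * y.1) / 2 - inner ℝ x.2.1 y.2.1)
    (fun x x' y => by simp [inner_add_left]; ring) (fun c x y => by simp; ring)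
    (fun x y y' => by simp [inner_add_right]; ring) (fun c x y => by simp; ring)

theorem lorentzForm_apply (x y : Mink) :
    lorentzForm x y = (x.1 * y.2.2 + x.2.2 * y.1) / 2 - inner ℝ x.2.1 y.2.1 := rfl

theorem lorentzForm_self (x : Mink) : lorentzForm x x = x.1 * x.2.2 - ‖x.2.1‖ ^ 2 := by
  rw [lorentzForm_apply, real_inner_self_eq_norm_sq]
  ring

theorem lorentzForm_comm (x y : Mink) : lorentzForm x y = lorentzForm y x := by
  rw [lorentzForm_apply, lorentzForm_apply, real_inner_comm]
  ring

theorem continuous_lorentzForm : Continuous fun p : Mink × Mink => lorentzForm p.1 p.2 := by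
  simp only [lorentzForm_apply]
  fun_prop

theorem lorentzForm_nondegenerate {x : Mink} (h : ∀ y, lorentzForm x y = 0) : x = 0 := by
  have h_fst : x.2.2 = 0 := by simpa [lorentzForm_apply] using h (1, 0, 0)
  have h_snd : x.2.1 = 0 := by simpa [lorentzForm_apply] using h (0, x.2.1, 0)
  have h_thd : x.1 = 0 := by simpa [lorentzForm_apply] using h (0, 0, 1)
  exact Prod.ext h_thd (Prod.ext h_snd h_fst)

/-- The trace of a vector of Minkowski space, seen as a Hermitian matrix. -/
noncomputable def minkTrace : Mink →L[ℝ] ℝ :=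
  ContinuousLinearMap.fst ℝ ℝ (ℂ × ℝ) +
    (ContinuousLinearMap.snd ℝ ℂ ℝ).comp (ContinuousLinearMap.snd ℝ ℝ (ℂ × ℝ))

@[simp] theorem minkTrace_apply (x : Mink) : minkTrace x = x.1 + x.2.2 := rfl

theorem lorentzForm_self_nonpos_of_minkTrace_eq_zero {x : Mink} (hx : minkTrace x = 0) :
    lorentzForm x x ≤ 0 := by
  have h : x.2.2 = -x.1 := eq_neg_of_add_eq_zero_right hx
  rw [lorentzForm_self, h]
  nlinarith [sq_nonneg x.1, sq_nonneg ‖x.2.1‖]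

/-- A form of signature `(1, 3)` satisfies the reverse Cauchy–Schwarz inequality. -/
theorem minkTrace_sq_mul_lorentzForm_add_le (x y : Mink) :
    minkTrace x ^ 2 * lorentzForm y y + minkTrace y ^ 2 * lorentzForm x x ≤
      2 * minkTrace x * minkTrace y * lorentzForm x y := by
  have h := lorentzForm_self_nonpos_of_minkTrace_eq_zero
    (x := minkTrace x • y - minkTrace y • x) (by simp only [map_sub, map_smul, smul_eq_mul]; ring)
  simp only [map_sub, map_smul, LinearMap.sub_apply, LinearMap.smul_apply, smul_eq_mul,
    lorentzForm_comm y x] at h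
  linarith

/-- The reflection `y ↦ (y.2.2, -y.2.1, y.1)` turns the upper bound into a lower bound. -/
theorem lorentzForm_le_minkTrace_mul {x y : Mink} (hx : 0 ≤ lorentzForm x x)
    (hy : 0 ≤ lorentzForm y y) (hx' : 0 < minkTrace x) (hy' : 0 < minkTrace y) :
    lorentzForm x y ≤ minkTrace x * minkTrace y / 2 := by
  let y' : Mink := (y.2.2, -y.2.1, y.1)
  have h_trace : minkTrace y' = minkTrace y := add_comm _ _
  have h_self : lorentzForm y' y' = lorentzForm y y := by
    simp only [y', lorentzForm_self, norm_neg]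
    ring
  have h_form : lorentzForm x y' = minkTrace x * minkTrace y / 2 - lorentzForm x y := by
    simp only [y', lorentzForm_apply, minkTrace_apply, inner_neg_right]
    ring
  have h := minkTrace_sq_mul_lorentzForm_add_le x y'
  rw [h_trace, h_self, h_form] at h
  have h_nonneg : 0 ≤ minkTrace x ^ 2 * lorentzForm y y + minkTrace y ^ 2 * lorentzForm x x := by
    positivity
  exact sub_nonneg.1 (nonneg_of_mul_nonneg_right (h_nonneg.trans h) (by positivity))

theorem norm_le_minkTrace {x : Mink} (hx : 0 ≤ lorentzForm x x) (h : 0 ≤ minkTrace x) :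
    ‖x‖ ≤ minkTrace x := by
  rw [lorentzForm_self] at hx
  rw [minkTrace_apply] at h ⊢
  have h_fst : 0 ≤ x.1 := by nlinarith [sq_nonneg ‖x.2.1‖]
  have h_thd : 0 ≤ x.2.2 := by nlinarith [sq_nonneg ‖x.2.1‖]
  have h_snd : ‖x.2.1‖ ≤ x.1 + x.2.2 := abs_le_of_sq_le_sq' (by nlinarith) h |>.2
  simp only [Prod.norm_def, Real.norm_of_nonneg h_fst, Real.norm_of_nonneg h_thd]
  exact max_le (by linarith) (max_le h_snd (by linarith))

/-- The lift of the compactified upper half space to the closed future light cone. It restricts to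
the hyperboloid model up to the factor `t`, and to the light cone for `t = 0`. -/
noncomputable def paraboloid (p : ℂ × ℝ) : Mink := (1, p.1, ‖p.1‖ ^ 2 + p.2 ^ 2)

theorem lorentzForm_paraboloid (p q : ℂ × ℝ) :
    lorentzForm (paraboloid p) (paraboloid q) = (‖p.1 - q.1‖ ^ 2 + p.2 ^ 2 + q.2 ^ 2) / 2 := by
  rw [lorentzForm_apply, norm_sub_sq_real]
  simp only [paraboloid]
  ring

theorem minkTrace_paraboloid (p : ℂ × ℝ) :
    minkTrace (paraboloid p) = 1 + ‖p.1‖ ^ 2 + p.2 ^ 2 := by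
  simp only [minkTrace_apply, paraboloid]
  ring

theorem minkTrace_paraboloid_pos (p : ℂ × ℝ) : 0 < minkTrace (paraboloid p) := by
  rw [minkTrace_paraboloid]
  positivity

theorem smul_paraboloid {a : ℝ} (ha : a ≠ 0) (z : ℂ) {c s : ℝ} (h : a * c = ‖z‖ ^ 2 + (a * s) ^ 2) :
    a • paraboloid (a⁻¹ • z, s) = (a, z, c) := by
  refine Prod.ext (mul_one a) (Prod.ext (smul_inv_smul₀ ha z) ?_)
  simp only [paraboloid, Prod.smul_snd, smul_eq_mul, norm_smul, mul_pow, norm_inv, inv_pow,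
    Real.norm_eq_abs, sq_abs]
  field_simp
  linarith

namespace HypThree

/-- The hyperboloid model of hyperbolic space. -/
noncomputable def hyperboloid (p : HypThree) : Mink := p.t⁻¹ • paraboloid (p.z, p.t)

theorem lorentzForm_hyperboloid (p q : HypThree) :
    lorentzForm p.hyperboloid q.hyperboloid = Real.cosh (dist p q) := by
  have hp := p.pos
  have hq := q.pos
  rw [show dist p q = 2 * (dist p q / 2) by ring, Real.cosh_two_mul, Real.cosh_sq,
    sinh_half_dist, div_pow, mul_pow, Real.sq_sqrt (mul_pos hp hq).le, sq_dist_toEuclid]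
  simp only [hyperboloid, map_smul, LinearMap.smul_apply, smul_eq_mul, lorentzForm_paraboloid]
  field_simp
  ring

theorem dist_eq_dist_iff {p q p' q' : HypThree} : dist p q = dist p' q' ↔
    lorentzForm p.hyperboloid q.hyperboloid = lorentzForm p'.hyperboloid q'.hyperboloid := by
  simp only [lorentzForm_hyperboloid]
  exact ⟨congrArg _, fun h => Real.cosh_injOn dist_nonneg dist_nonneg h⟩

theorem hyperboloid_injective : Function.Injective hyperboloid := fun p q h => by
  rw [← dist_eq_zero, ← dist_self p, dist_eq_dist_iff, h]

theorem lorentzForm_hyperboloid_self (p : HypThree) :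
    lorentzForm p.hyperboloid p.hyperboloid = 1 := by
  rw [lorentzForm_hyperboloid, dist_self, Real.cosh_zero]

theorem exists_hyperboloid_eq {x : Mink} (h : lorentzForm x x = 1) (h0 : 0 ≤ x.1) :
    ∃ p : HypThree, p.hyperboloid = x := by
  obtain ⟨a, z, c⟩ := x
  rw [lorentzForm_self] at h
  have ha : 0 < a := h0.lt_of_ne' fun ha : a = 0 => by
    rw [ha, zero_mul] at h
    linarith [sq_nonneg ‖z‖]
  refine ⟨⟨a⁻¹ • z, a⁻¹, inv_pos.2 ha⟩, ?_⟩
  rw [hyperboloid, inv_inv]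
  refine smul_paraboloid ha.ne' z ?_
  rw [mul_inv_cancel₀ ha.ne', one_pow]
  linarith

/-- The base point of hyperbolic space; the trace is the Lorentz product with twice its image in
the hyperboloid model. -/
def base : HypThree := ⟨0, 1, one_pos⟩

theorem minkTrace_eq_lorentzForm (x : Mink) :
    minkTrace x = 2 * lorentzForm x base.hyperboloid := by
  simp [lorentzForm_apply, hyperboloid, paraboloid, base]
  ring

theorem minkTrace_hyperboloid (p : HypThree) :
    minkTrace p.hyperboloid = 2 * Real.cosh (dist p base) := by
  rw [minkTrace_eq_lorentzForm, lorentzForm_hyperboloid]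

theorem minkTrace_hyperboloid_pos (p : HypThree) : 0 < minkTrace p.hyperboloid := by
  rw [minkTrace_hyperboloid]
  positivity [Real.cosh_pos (dist p base)]

theorem norm_hyperboloid_le (p : HypThree) :
    ‖p.hyperboloid‖ ≤ 2 * Real.cosh (dist p base) := by
  rw [← minkTrace_hyperboloid]
  refine norm_le_minkTrace ?_ p.minkTrace_hyperboloid_pos.le
  rw [lorentzForm_hyperboloid_self]
  exact zero_le_one

/-- Four points whose images in the hyperboloid model form a basis of Minkowski space. -/
def frame : Fin 4 → HypThree :=
  ![⟨0, 1, one_pos⟩, ⟨1, 1, one_pos⟩, ⟨Complex.I, 1, one_pos⟩, ⟨0, 2, two_pos⟩]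

theorem linearIndependent_hyperboloid_frame :
    LinearIndependent ℝ fun i => (frame i).hyperboloid := by
  rw [Fintype.linearIndependent_iff]
  intro g hg
  rw [Fin.sum_univ_four] at hg
  have h_fst : g 0 + g 1 + g 2 + g 3 * 2⁻¹ = 0 := by
    simpa [frame, hyperboloid, paraboloid] using congrArg Prod.fst hg
  have h_re : g 1 = 0 := by
    simpa [frame, hyperboloid, paraboloid] using congrArg (fun x => x.2.1.re) hg
  have h_im : g 2 = 0 := by
    simpa [frame, hyperboloid, paraboloid] using congrArg (fun x => x.2.1.im) hg
  have h_thd : g 0 + g 1 * (1 + 1) + g 2 * (1 + 1) + g 3 * (2⁻¹ * 2 ^ 2) = 0 := by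
    simpa [frame, hyperboloid, paraboloid] using congrArg (fun x => x.2.2) hg
  intro i
  fin_cases i <;> simp only [Fin.zero_eta, Fin.mk_one, Fin.reduceFinMk] <;> linarith

/-- The basis of Minkowski space given by the points of `frame`. -/
noncomputable def frameBasis : Module.Basis (Fin 4) ℝ Mink :=
  basisOfLinearIndependentOfCardEqFinrank linearIndependent_hyperboloid_frame (by simp)

theorem frameBasis_apply (i : Fin 4) : frameBasis i = (frame i).hyperboloid := by
  simp [frameBasis]

/-- The linear map of Minkowski space that agrees with a map of hyperbolic space on `frame`; for an
isometry they agree on the whole hyperboloid. -/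
noncomputable def linearize (a : HypThree → HypThree) : Mink →L[ℝ] Mink :=
  frameBasis.constrL fun i => (a (frame i)).hyperboloid

theorem linearize_frame (a : HypThree → HypThree) (i : Fin 4) :
    linearize a (frame i).hyperboloid = (a (frame i)).hyperboloid := by
  rw [← frameBasis_apply, linearize, Module.Basis.constrL_basis]

theorem lorentzForm_linearize {a : HypThree → HypThree} (ha : Isometry a) (x y : Mink) :
    lorentzForm (linearize a x) (linearize a y) = lorentzForm x y := by
  have h : lorentzForm.comp (linearize a : Mink →ₗ[ℝ] Mink) (linearize a) = lorentzForm := by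
    refine LinearMap.BilinForm.ext_basis frameBasis fun i j => ?_
    simp only [LinearMap.BilinForm.comp_apply, ContinuousLinearMap.coe_coe, frameBasis_apply,
      linearize_frame]
    exact dist_eq_dist_iff.1 (ha.dist_eq _ _)
  exact congrArg (fun B : LinearMap.BilinForm ℝ Mink => B x y) h

theorem linearize_surjective {a : HypThree → HypThree} (ha : Isometry a) :
    Function.Surjective (linearize a) := by
  refine LinearMap.surjective_of_injective (f := (linearize a : Mink →ₗ[ℝ] Mink)) ?_
  refine (injective_iff_map_eq_zero _).2 fun x hx => lorentzForm_nondegenerate fun y => ?_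
  rw [ContinuousLinearMap.coe_coe] at hx
  rw [← lorentzForm_linearize ha, hx, map_zero, LinearMap.zero_apply]

theorem linearize_hyperboloid {a : HypThree → HypThree} (ha : Isometry a) (p : HypThree) :
    linearize a p.hyperboloid = (a p).hyperboloid := by
  have h : (lorentzForm (linearize a p.hyperboloid)).comp (linearize a : Mink →ₗ[ℝ] Mink) =
      (lorentzForm (a p).hyperboloid).comp (linearize a : Mink →ₗ[ℝ] Mink) := by
    refine frameBasis.ext fun i => ?_
    simp only [LinearMap.comp_apply, ContinuousLinearMap.coe_coe, frameBasis_apply,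
      lorentzForm_linearize ha]
    rw [linearize_frame, dist_eq_dist_iff.1 (ha.dist_eq p (frame i))]
  rw [← sub_eq_zero]
  refine lorentzForm_nondegenerate fun y => ?_
  obtain ⟨y, rfl⟩ := linearize_surjective ha y
  rw [map_sub, LinearMap.sub_apply, sub_eq_zero]
  exact LinearMap.congr_fun h y

theorem linearize_mul (a b : HypThree ≃ᵢ HypThree) :
    linearize (a * b) = linearize a * linearize b := by
  refine ContinuousLinearMap.coe_injective (frameBasis.ext fun i => ?_)
  simp only [frameBasis_apply, ContinuousLinearMap.coe_coe, linearize_frame,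
    linearize_hyperboloid a.isometry, mul_apply_eq_comp]
  rfl

theorem linearize_one : linearize (1 : HypThree ≃ᵢ HypThree) = 1 := by
  refine ContinuousLinearMap.coe_injective (frameBasis.ext fun i => ?_)
  simp only [frameBasis_apply, ContinuousLinearMap.coe_coe, linearize_frame]
  rfl

end HypThree

/-- An embedding of the compactification of `ℂ × ℝ` whose first component is the point of the
projectivized light cone and its interior; the last component records the sign of the height. -/
noncomputable def ballEmbedding (x : OnePoint (ℂ × ℝ)) : Mink × ℝ :=
  x.elim ((0, 0, 1), 0) fun p : ℂ × ℝ => (minkTrace (paraboloid p))⁻¹ • (paraboloid p, p.2)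

theorem ballEmbedding_coe (p : ℂ × ℝ) : ballEmbedding (p : OnePoint (ℂ × ℝ)) =
    (minkTrace (paraboloid p))⁻¹ • (paraboloid p, p.2) := rfl

theorem ballEmbedding_infty : ballEmbedding OnePoint.infty = ((0, 0, 1), 0) := rfl

theorem tendsto_minkTrace_paraboloid_cocompact :
    Tendsto (fun p => minkTrace (paraboloid p)) (cocompact (ℂ × ℝ)) atTop := by
  refine tendsto_atTop_mono (fun p => ?_)
    ((tendsto_pow_atTop two_ne_zero).comp (tendsto_norm_cocompact_atTop (E := ℂ × ℝ)))
  rw [minkTrace_paraboloid, Function.comp_apply, Prod.norm_def]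
  rcases max_choice ‖p.1‖ ‖p.2‖ with h | h <;> rw [h]
  · linarith [sq_nonneg p.2]
  · rw [Real.norm_eq_abs, sq_abs]
    linarith [sq_nonneg ‖p.1‖]

theorem norm_ballEmbedding_sub_infty_le (p : ℂ × ℝ) :
    ‖ballEmbedding p - ballEmbedding OnePoint.infty‖ ≤ (√(minkTrace (paraboloid p)))⁻¹ := by
  have hpos := minkTrace_paraboloid_pos p
  have h_sub : ballEmbedding p - ballEmbedding OnePoint.infty =
      (minkTrace (paraboloid p))⁻¹ • ((1, p.1, -1), p.2) := by
    rw [eq_inv_smul_iff₀ hpos.ne', smul_sub, ballEmbedding_coe, ballEmbedding_infty,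
      smul_inv_smul₀ hpos.ne', minkTrace_paraboloid]
    simp [paraboloid]
  have h_norm : ‖(((1, p.1, -1), p.2) : Mink × ℝ)‖ ≤ √(minkTrace (paraboloid p)) := by
    simp only [Prod.norm_def, minkTrace_paraboloid, sup_le_iff, norm_one, norm_neg,
      Real.norm_eq_abs]
    refine ⟨⟨?_, ?_, ?_⟩, ?_⟩ <;> refine Real.le_sqrt_of_sq_le ?_ <;>
      nlinarith [sq_nonneg p.2, sq_nonneg ‖p.1‖, sq_abs p.2]
  rw [h_sub, norm_smul, Real.norm_of_nonneg (inv_pos.2 hpos).le, inv_mul_le_iff₀ hpos,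
    ← div_eq_mul_inv, Real.div_sqrt]
  exact h_norm

theorem continuous_ballEmbedding : Continuous ballEmbedding := by
  rw [OnePoint.continuous_iff, coclosedCompact_eq_cocompact]
  constructor
  · rw [tendsto_iff_norm_sub_tendsto_zero]
    exact squeeze_zero (fun _ => norm_nonneg _) norm_ballEmbedding_sub_infty_le
      (Real.tendsto_sqrt_atTop.comp tendsto_minkTrace_paraboloid_cocompact).inv_tendsto_atTop
  · have h : Continuous paraboloid := by unfold paraboloid; fun_prop
    exact ((minkTrace.continuous.comp h).inv₀ fun p => (minkTrace_paraboloid_pos p).ne').smul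
      (h.prodMk continuous_snd)

theorem ballEmbedding_injective : Function.Injective ballEmbedding := by
  have h_ne (p : ℂ × ℝ) : (minkTrace (paraboloid p))⁻¹ ≠ 0 :=
    (inv_pos.2 (minkTrace_paraboloid_pos p)).ne'
  have h_fst (p : ℂ × ℝ) : (ballEmbedding p).1.1 = (minkTrace (paraboloid p))⁻¹ := mul_one _
  intro p q h
  have h_eq := congrArg (fun x => x.1.1) h
  induction p using OnePoint.rec with
  | infty =>
    induction q using OnePoint.rec with
    | infty => rfl
    | coe q => exact absurd (h_eq.trans (h_fst q)).symm (h_ne q)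
  | coe p =>
    induction q using OnePoint.rec with
    | infty => exact absurd ((h_fst p).symm.trans h_eq) (h_ne p)
    | coe q =>
      simp only [h_fst] at h_eq
      rw [ballEmbedding_coe, ballEmbedding_coe, h_eq] at h
      have h_pair := smul_right_injective (Mink × ℝ) (h_ne q) h
      have h_z : p.1 = q.1 := congrArg (fun x => x.1.2.1) h_pair
      have h_t : p.2 = q.2 := congrArg (fun x => x.2) h_pair
      rw [Prod.ext h_z h_t]

theorem isClosedEmbedding_ballEmbedding : IsClosedEmbedding ballEmbedding :=
  continuous_ballEmbedding.isClosedEmbedding ballEmbedding_injective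

namespace RSphere

theorem toBall_injective : Function.Injective toBall :=
  Option.map_injective fun _ _ h => congrArg Prod.fst h

theorem continuous_toBall : Continuous toBall := by
  refine OnePoint.continuous_map (by fun_prop) ?_
  simp only [coclosedCompact_eq_cocompact]
  have h : Isometry fun z : ℂ => (z, (0 : ℝ)) :=
    Isometry.of_dist_eq fun x y => by simp [Prod.dist_eq]
  exact h.isClosedEmbedding.tendsto_cocompact

/-- The Riemann sphere as the projectivized light cone, normalized to trace one. -/
noncomputable def toCone (ξ : RSphere) : Mink := (ballEmbedding ξ.toBall).1

theorem toCone_coe (z : ℂ) : toCone (z : RSphere) = (1 + ‖z‖ ^ 2)⁻¹ • paraboloid (z, 0) := by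
  change (minkTrace (paraboloid (z, 0)))⁻¹ • paraboloid (z, 0) = _
  rw [minkTrace_paraboloid, zero_pow two_ne_zero, add_zero]

theorem toCone_infty : toCone OnePoint.infty = (0, 0, 1) := rfl

theorem ballEmbedding_toBall (ξ : RSphere) : ballEmbedding ξ.toBall = (ξ.toCone, 0) := by
  induction ξ using OnePoint.rec with
  | infty => rfl
  | coe z => exact Prod.ext rfl (smul_zero _)

theorem continuous_toCone : Continuous toCone :=
  continuous_fst.comp (continuous_ballEmbedding.comp continuous_toBall)

theorem toCone_injective : Function.Injective toCone := fun ξ η h =>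
  toBall_injective (ballEmbedding_injective (by rw [ballEmbedding_toBall, ballEmbedding_toBall, h]))

theorem isClosedEmbedding_toCone : IsClosedEmbedding toCone :=
  continuous_toCone.isClosedEmbedding toCone_injective

theorem minkTrace_toCone (ξ : RSphere) : minkTrace ξ.toCone = 1 := by
  induction ξ using OnePoint.rec with
  | infty => simp [toCone_infty]
  | coe z =>
    rw [toCone_coe, map_smul, minkTrace_paraboloid, smul_eq_mul, zero_pow two_ne_zero, add_zero]
    exact inv_mul_cancel₀ (by positivity)

theorem lorentzForm_toCone_self (ξ : RSphere) : lorentzForm ξ.toCone ξ.toCone = 0 := by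
  induction ξ using OnePoint.rec with
  | infty => simp [toCone_infty, lorentzForm_self]
  | coe z => simp [toCone_coe, lorentzForm_paraboloid]

theorem exists_toCone_eq {x : Mink} (h : lorentzForm x x = 0) (h1 : minkTrace x = 1) :
    ∃ ξ : RSphere, ξ.toCone = x := by
  obtain ⟨a, z, c⟩ := x
  rw [lorentzForm_self, sub_eq_zero] at h
  obtain rfl | ha := eq_or_ne a 0
  · have hz : z = 0 := by simpa [eq_comm] using h
    have hc : c = 1 := by simpa using h1
    exact ⟨OnePoint.infty, by rw [toCone_infty, hz, hc]⟩
  · refine ⟨((a⁻¹ • z : ℂ) : RSphere), ?_⟩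
    have h_trace : 1 + ‖a⁻¹ • z‖ ^ 2 = a⁻¹ := by
      rw [norm_smul, mul_pow, Real.norm_eq_abs, sq_abs, ← h, inv_pow]
      rw [minkTrace_apply] at h1
      field_simp
      exact h1
    rw [toCone_coe, h_trace, inv_inv]
    exact smul_paraboloid ha z (by simpa using h)

theorem lorentzForm_toCone_hyperboloid_pos (ξ : RSphere) (p : HypThree) :
    0 < lorentzForm ξ.toCone p.hyperboloid := by
  have := p.pos
  have h := minkTrace_sq_mul_lorentzForm_add_le ξ.toCone p.hyperboloid
  rw [minkTrace_toCone, lorentzForm_toCone_self, HypThree.lorentzForm_hyperboloid_self] at h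
  have h_trace := p.minkTrace_hyperboloid_pos
  exact pos_of_mul_pos_right (a := 2 * minkTrace p.hyperboloid) (by linarith) (by positivity)

/-- One eighth of the squared chordal distance of two points of the sphere. -/
noncomputable def sqChord (ξ η : RSphere) : ℝ := lorentzForm ξ.toCone η.toCone

theorem sqChord_self (ξ : RSphere) : sqChord ξ ξ = 0 := lorentzForm_toCone_self ξ

theorem sqChord_comm (ξ η : RSphere) : sqChord ξ η = sqChord η ξ := lorentzForm_comm _ _

theorem continuous_sqChord : Continuous fun p : RSphere × RSphere => sqChord p.1 p.2 :=
  continuous_lorentzForm.comp ((continuous_toCone.comp continuous_fst).prodMk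
    (continuous_toCone.comp continuous_snd))

theorem sqChord_coe (z w : ℂ) : sqChord z w =
    ‖z - w‖ ^ 2 / (2 * (1 + ‖z‖ ^ 2) * (1 + ‖w‖ ^ 2)) := by
  simp only [sqChord, toCone_coe, map_smul, LinearMap.smul_apply, smul_eq_mul,
    lorentzForm_paraboloid]
  field_simp
  ring

theorem sqChord_coe_infty (z : ℂ) : sqChord z OnePoint.infty = 1 / (2 * (1 + ‖z‖ ^ 2)) := by
  rw [sqChord, toCone_coe, toCone_infty, map_smul, LinearMap.smul_apply, smul_eq_mul,
    lorentzForm_apply]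
  simp [paraboloid]

theorem sqChord_coe_eq_mul (z w : ℂ) :
    sqChord z w = 2 * ‖z - w‖ ^ 2 * sqChord z OnePoint.infty * sqChord w OnePoint.infty := by
  simp only [sqChord_coe, sqChord_coe_infty]
  field_simp

theorem sqChord_pos {ξ η : RSphere} (h : ξ ≠ η) : 0 < sqChord ξ η := by
  induction ξ using OnePoint.rec with
  | infty =>
    induction η using OnePoint.rec with
    | infty => exact absurd rfl h
    | coe w => rw [sqChord_comm, sqChord_coe_infty]; positivity
  | coe z =>
    induction η using OnePoint.rec with
    | infty => rw [sqChord_coe_infty]; positivity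
    | coe w =>
      have : 0 < ‖z - w‖ := norm_pos_iff.2 (sub_ne_zero.2 fun hzw => h (by rw [hzw]))
      rw [sqChord_coe]
      positivity

theorem sqChord_nonneg (ξ η : RSphere) : 0 ≤ sqChord ξ η := by
  obtain rfl | h := eq_or_ne ξ η
  exacts [(sqChord_self ξ).ge, (sqChord_pos h).le]

theorem sqChord_le_half (ξ η : RSphere) : sqChord ξ η ≤ 1 / 2 := by
  have h := lorentzForm_le_minkTrace_mul (lorentzForm_toCone_self ξ).ge
    (lorentzForm_toCone_self η).ge
  rw [minkTrace_toCone, minkTrace_toCone, one_mul] at h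
  exact h one_pos one_pos

theorem sqChord_mul_minkTrace_le (ξ η : RSphere) (p : HypThree) :
    sqChord ξ η * minkTrace p.hyperboloid ≤
      2 * (lorentzForm ξ.toCone p.hyperboloid + lorentzForm η.toCone p.hyperboloid) := by
  have h := minkTrace_sq_mul_lorentzForm_add_le (ξ.toCone + η.toCone) p.hyperboloid
  have h_sum : lorentzForm (ξ.toCone + η.toCone) (ξ.toCone + η.toCone) = 2 * sqChord ξ η := by
    simp only [map_add, LinearMap.add_apply, lorentzForm_toCone_self]
    rw [← sqChord, ← sqChord, sqChord_comm η ξ]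
    ring
  rw [h_sum, p.lorentzForm_hyperboloid_self, map_add, map_add, LinearMap.add_apply,
    minkTrace_toCone, minkTrace_toCone] at h
  refine le_of_mul_le_mul_left ?_ p.minkTrace_hyperboloid_pos
  linarith

end RSphere

namespace HypThree

/-- The projective (Klein) model of hyperbolic space, normalized to trace one. -/
noncomputable def toCone (p : HypThree) : Mink := (minkTrace p.hyperboloid)⁻¹ • p.hyperboloid

theorem lorentzForm_toCone_self (p : HypThree) :
    lorentzForm p.toCone p.toCone = ((minkTrace p.hyperboloid)⁻¹) ^ 2 := by
  simp only [toCone, map_smul, LinearMap.smul_apply, lorentzForm_hyperboloid_self, smul_eq_mul]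
  ring

theorem ballEmbedding_toBall (p : HypThree) :
    ballEmbedding p.toBall = (p.toCone, √(lorentzForm p.toCone p.toCone)) := by
  rw [lorentzForm_toCone_self, Real.sqrt_sq (inv_pos.2 p.minkTrace_hyperboloid_pos).le, toCone,
    hyperboloid, map_smul, smul_smul, smul_eq_mul, mul_inv, inv_inv, mul_right_comm,
    mul_inv_cancel₀ p.pos.ne', one_mul, mul_comm p.t]
  rfl

theorem comap_toBall_nhds (ξ : RSphere) :
    comap toBall (𝓝 ξ.toBall) = comap toCone (𝓝 ξ.toCone) := by
  have h_comp : ballEmbedding ∘ toBall = fun p => (p.toCone, √(lorentzForm p.toCone p.toCone)) :=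
    funext ballEmbedding_toBall
  rw [isClosedEmbedding_ballEmbedding.isInducing.nhds_eq_comap, comap_comap,
    RSphere.ballEmbedding_toBall, h_comp, nhds_prod_eq, comap_prod]
  refine le_antisymm inf_le_left (le_inf le_rfl (tendsto_iff_comap.1 ?_))
  have h_cont : Continuous fun x : Mink => √(lorentzForm x x) :=
    Real.continuous_sqrt.comp (continuous_lorentzForm.comp (continuous_id.prodMk continuous_id))
  have h_lim := h_cont.tendsto ξ.toCone
  rw [RSphere.lorentzForm_toCone_self, Real.sqrt_zero] at h_lim
  exact h_lim.comp tendsto_comap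

end HypThree

/-! ### Isometries acting on the sphere at infinity -/

theorem isBoundaryExtension_iff {H : HypThree → HypThree} {h : RSphere ≃ₜ RSphere} :
    IsBoundaryExtension H h ↔ ∀ ξ : RSphere, Tendsto H (comap HypThree.toBall (𝓝 ξ.toBall))
      (comap HypThree.toBall (𝓝 (h ξ).toBall)) :=
  forall_congr' fun _ => (tendsto_comap_iff (g := HypThree.toBall)).symm

theorem IsBoundaryExtension.comp {G H : HypThree → HypThree} {g h : RSphere ≃ₜ RSphere}
    (hg : IsBoundaryExtension G g) (hh : IsBoundaryExtension H h) :
    IsBoundaryExtension (G ∘ H) (g * h) := by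
  rw [isBoundaryExtension_iff] at *
  exact fun ξ => (hg (h ξ)).comp (hh ξ)

theorem neBot_comap_toBall_of_tendsto {ξ : RSphere} {l : Filter ℝ} [l.NeBot] (z : ℂ)
    (hl : ∀ᶠ t in l, 0 < t)
    (h : Tendsto (fun t => (((z, t) : ℂ × ℝ) : OnePoint (ℂ × ℝ))) l (𝓝 ξ.toBall)) :
    (comap HypThree.toBall (𝓝 ξ.toBall)).NeBot := by
  refine comap_neBot_iff.2 fun s hs => ?_
  obtain ⟨t, ht, hts⟩ := (hl.and (h.eventually_mem hs)).exists
  exact ⟨⟨z, t, ht⟩, hts⟩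

instance neBot_comap_toBall (ξ : RSphere) : (comap HypThree.toBall (𝓝 ξ.toBall)).NeBot := by
  induction ξ using OnePoint.rec with
  | infty =>
    have h_line : Isometry fun t : ℝ => ((0 : ℂ), t) :=
      Isometry.of_dist_eq fun x y => by simp [Prod.dist_eq]
    have h_infty := OnePoint.tendsto_coe_infty (X := ℂ × ℝ)
    rw [coclosedCompact_eq_cocompact] at h_infty
    exact neBot_comap_toBall_of_tendsto (l := atTop) 0 (eventually_gt_atTop 0)
      (h_infty.comp (h_line.isClosedEmbedding.tendsto_cocompact.comp atTop_le_cocompact))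
  | coe z =>
    have h_cont : Continuous fun t : ℝ => (((z, t) : ℂ × ℝ) : OnePoint (ℂ × ℝ)) :=
      OnePoint.continuous_coe.comp (by fun_prop)
    exact neBot_comap_toBall_of_tendsto (l := 𝓝[>] 0) z self_mem_nhdsWithin
      ((h_cont.tendsto 0).mono_left nhdsWithin_le_nhds)

theorem IsBoundaryExtension.unique {H : HypThree → HypThree} {h h' : RSphere ≃ₜ RSphere}
    (h1 : IsBoundaryExtension H h) (h2 : IsBoundaryExtension H h') : h = h' := by
  ext ξ
  exact RSphere.toBall_injective (tendsto_nhds_unique (h1 ξ) (h2 ξ))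

namespace HypThree

theorem linearize_inv_mul_linearize (a : HypThree ≃ᵢ HypThree) :
    linearize ⇑a⁻¹ * linearize a = 1 := by
  rw [← linearize_mul, inv_mul_cancel, linearize_one]

theorem linearize_inv_apply_linearize (a : HypThree ≃ᵢ HypThree) (x : Mink) :
    linearize ⇑a⁻¹ (linearize a x) = x :=
  DFunLike.congr_fun (linearize_inv_mul_linearize a) x

/-- The factor by which the linear action of an isometry stretches a normalized light vector, that
is, the inverse of its conformal factor at the corresponding ideal point. -/
noncomputable def stretch (a : HypThree ≃ᵢ HypThree) (ξ : RSphere) : ℝ :=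
  minkTrace (linearize a ξ.toCone)

theorem stretch_eq (a : HypThree ≃ᵢ HypThree) (ξ : RSphere) :
    stretch a ξ = 2 * lorentzForm ξ.toCone (a⁻¹ base).hyperboloid := by
  rw [stretch, minkTrace_eq_lorentzForm, ← lorentzForm_linearize a⁻¹.isometry,
    linearize_inv_apply_linearize, linearize_hyperboloid a⁻¹.isometry]

theorem stretch_pos (a : HypThree ≃ᵢ HypThree) (ξ : RSphere) : 0 < stretch a ξ := by
  rw [stretch_eq]
  exact mul_pos two_pos (RSphere.lorentzForm_toCone_hyperboloid_pos ξ _)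

theorem exists_toCone_eq_inv_stretch_smul (a : HypThree ≃ᵢ HypThree) (ξ : RSphere) :
    ∃ η : RSphere, η.toCone = (stretch a ξ)⁻¹ • linearize a ξ.toCone := by
  refine RSphere.exists_toCone_eq ?_ ?_
  · simp only [map_smul, LinearMap.smul_apply, lorentzForm_linearize a.isometry,
      RSphere.lorentzForm_toCone_self, smul_zero]
  · rw [map_smul, smul_eq_mul]
    exact inv_mul_cancel₀ (stretch_pos a ξ).ne'

/-- The action of an isometry on the projectivized light cone. -/
noncomputable def boundaryMap (a : HypThree ≃ᵢ HypThree) (ξ : RSphere) : RSphere :=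
  (exists_toCone_eq_inv_stretch_smul a ξ).choose

theorem toCone_boundaryMap (a : HypThree ≃ᵢ HypThree) (ξ : RSphere) :
    (boundaryMap a ξ).toCone = (stretch a ξ)⁻¹ • linearize a ξ.toCone :=
  (exists_toCone_eq_inv_stretch_smul a ξ).choose_spec

theorem boundaryMap_inv_apply_boundaryMap (a : HypThree ≃ᵢ HypThree) (ξ : RSphere) :
    boundaryMap a⁻¹ (boundaryMap a ξ) = ξ := by
  apply RSphere.toCone_injective
  rw [toCone_boundaryMap, stretch, toCone_boundaryMap, map_smul, linearize_inv_apply_linearize,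
    map_smul, RSphere.minkTrace_toCone, smul_smul, smul_eq_mul, mul_one, inv_inv,
    mul_inv_cancel₀ (stretch_pos a ξ).ne', one_smul]

theorem continuous_boundaryMap (a : HypThree ≃ᵢ HypThree) : Continuous (boundaryMap a) := by
  rw [RSphere.isClosedEmbedding_toCone.isInducing.continuous_iff]
  have h : Continuous fun ξ : RSphere => linearize a ξ.toCone :=
    (linearize a).continuous.comp RSphere.continuous_toCone
  exact Continuous.congr
    (((minkTrace.continuous.comp h).inv₀ fun ξ => (stretch_pos a ξ).ne').smul h)
    fun ξ => (toCone_boundaryMap a ξ).symm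

/-- The action of an isometry on the sphere, as a homeomorphism. -/
noncomputable def boundaryHomeo (a : HypThree ≃ᵢ HypThree) : RSphere ≃ₜ RSphere where
  toFun := boundaryMap a
  invFun := boundaryMap a⁻¹
  left_inv := boundaryMap_inv_apply_boundaryMap a
  right_inv := boundaryMap_inv_apply_boundaryMap a⁻¹
  continuous_toFun := continuous_boundaryMap a
  continuous_invFun := continuous_boundaryMap a⁻¹

theorem toCone_boundaryHomeo (a : HypThree ≃ᵢ HypThree) (ξ : RSphere) :
    (boundaryHomeo a ξ).toCone = (stretch a ξ)⁻¹ • linearize a ξ.toCone :=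
  toCone_boundaryMap a ξ

theorem toCone_apply (a : HypThree ≃ᵢ HypThree) (p : HypThree) :
    (a p).toCone = (minkTrace (linearize a p.toCone))⁻¹ • linearize a p.toCone := by
  simp only [toCone, map_smul, linearize_hyperboloid a.isometry, smul_smul, smul_eq_mul, mul_inv,
    inv_inv]
  rw [mul_right_comm, mul_inv_cancel₀ p.minkTrace_hyperboloid_pos.ne', one_mul]

theorem isBoundaryExtension_boundaryHomeo (a : HypThree ≃ᵢ HypThree) :
    IsBoundaryExtension a (boundaryHomeo a) := by
  refine isBoundaryExtension_iff.2 fun ξ => ?_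
  rw [comap_toBall_nhds, comap_toBall_nhds, tendsto_comap_iff, toCone_boundaryHomeo,
    show toCone ∘ a = (fun x => (minkTrace (linearize a x))⁻¹ • linearize a x) ∘ toCone from
      funext (toCone_apply a)]
  refine Tendsto.comp (y := 𝓝 ξ.toCone) ?_ tendsto_comap
  exact ((minkTrace.continuous.comp (linearize a).continuous).continuousAt.inv₀
    (stretch_pos a ξ).ne').smul (linearize a).continuous.continuousAt

theorem boundaryHomeo_mul (a b : HypThree ≃ᵢ HypThree) :
    boundaryHomeo (a * b) = boundaryHomeo a * boundaryHomeo b :=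
  (isBoundaryExtension_boundaryHomeo (a * b)).unique
    ((isBoundaryExtension_boundaryHomeo a).comp (isBoundaryExtension_boundaryHomeo b))

theorem boundaryHomeo_one : boundaryHomeo 1 = 1 := by
  have h := boundaryHomeo_mul 1 1
  rwa [one_mul, left_eq_mul] at h

theorem boundaryHomeo_inv (a : HypThree ≃ᵢ HypThree) :
    boundaryHomeo a⁻¹ = (boundaryHomeo a)⁻¹ := by
  rw [eq_inv_iff_mul_eq_one, ← boundaryHomeo_mul, inv_mul_cancel, boundaryHomeo_one]

theorem sqChord_boundaryHomeo (a : HypThree ≃ᵢ HypThree) (ξ η : RSphere) :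
    (boundaryHomeo a ξ).sqChord (boundaryHomeo a η) =
      ξ.sqChord η / (stretch a ξ * stretch a η) := by
  simp only [RSphere.sqChord, toCone_boundaryHomeo, map_smul, LinearMap.smul_apply,
    lorentzForm_linearize a.isometry, smul_eq_mul]
  field_simp

end HypThree

/-- Continuous convergence of a family of maps: `F i x'` tends to `f x` as `x'` tends to `x`. -/
def TendstoContinuously {ι X Y : Type*} [TopologicalSpace X] [TopologicalSpace Y]
    (F : ι → X → Y) (f : X → Y) (l : Filter ι) : Prop :=
  ∀ x, Tendsto (fun p : ι × X => F p.1 p.2) (l ×ˢ 𝓝 x) (𝓝 (f x))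

namespace TendstoContinuously

variable {ι X Y Z : Type*} [TopologicalSpace X] [TopologicalSpace Y] [TopologicalSpace Z]
  {l : Filter ι} {F : ι → X → Y} {f : X → Y}

theorem const (hf : Continuous f) (l : Filter ι) : TendstoContinuously (fun _ => f) f l :=
  fun x => (hf.tendsto x).comp tendsto_snd

theorem comp {G : ι → Y → Z} {g : Y → Z} (hG : TendstoContinuously G g l)
    (hF : TendstoContinuously F f l) : TendstoContinuously (fun i => G i ∘ F i) (g ∘ f) l :=
  fun x => (hG (f x)).comp (tendsto_fst.prodMk (hF x))

theorem tendsto_apply (hF : TendstoContinuously F f l) {u : ι → X} {x : X}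
    (hu : Tendsto u l (𝓝 x)) : Tendsto (fun i => F i (u i)) l (𝓝 (f x)) :=
  (hF x).comp (tendsto_id.prodMk hu)

theorem tendstoUniformlyOn {Y : Type*} [UniformSpace Y] {F : ι → X → Y} {f : X → Y}
    (hF : TendstoContinuously F f l) (hf : Continuous f) {K : Set X} (hK : IsCompact K) :
    TendstoUniformlyOn F f l K := by
  rw [← tendstoLocallyUniformlyOn_iff_tendstoUniformlyOn_of_compact hK]
  refine TendstoLocallyUniformly.tendstoLocallyUniformlyOn ?_
  rw [tendstoLocallyUniformly_iff_forall_tendsto]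
  intro x
  refine Tendsto.mono_right ?_ (nhds_le_uniformity (f x))
  rw [nhds_prod_eq]
  exact ((hf.tendsto x).comp tendsto_snd).prodMk (hF x)

theorem sphereTendstoUniformly {F : ℕ → RSphere → RSphere} {f : RSphere → RSphere}
    (hF : TendstoContinuously F f atTop) (hf : Continuous f) : SphereTendstoUniformly F f := by
  let _ : UniformSpace RSphere := uniformSpaceOfCompactR1
  exact tendstoUniformlyOn_univ.1 (hF.tendstoUniformlyOn hf isCompact_univ)

end TendstoContinuously

namespace HypThree

theorem tendsto_of_lorentzForm_tendsto {ι : Type*} {l : Filter ι} {p : ι → HypThree} {q : HypThree}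
    (h : Tendsto (fun i => lorentzForm (p i).hyperboloid q.hyperboloid) l (𝓝 1)) :
    Tendsto p l (𝓝 q) := by
  simp only [lorentzForm_hyperboloid] at h
  have h_arcosh := (Real.continuousOn_arcosh 1 self_mem_Ici).tendsto.comp
    (tendsto_nhdsWithin_iff.2 ⟨h, Eventually.of_forall fun i => Real.one_le_cosh _⟩)
  rw [Real.arcosh_zero] at h_arcosh
  exact tendsto_iff_dist_tendsto_zero.2 (h_arcosh.congr fun i => Real.arcosh_cosh dist_nonneg)

theorem exists_norm_linearize_le (R : ℝ) : ∃ C, ∀ a : HypThree ≃ᵢ HypThree,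
    dist (a base) base ≤ R → ‖linearize a‖ ≤ C := by
  obtain ⟨C, -, hC⟩ := frameBasis.exists_opNorm_le (F := Mink)
  let D := ∑ i, dist (frame i) base
  refine ⟨C * (2 * Real.cosh (D + R)), fun a ha => hC (by positivity) fun i => ?_⟩
  have h_dist : dist (a (frame i)) base ≤ D + R :=
    (dist_triangle _ (a base) _).trans (add_le_add ((a.dist_eq _ _).trans_le
      (Finset.single_le_sum (f := fun i => dist (frame i) base) (fun _ _ => dist_nonneg)
        (Finset.mem_univ i))) ha)
  rw [frameBasis_apply, linearize_frame]
  refine (norm_hyperboloid_le _).trans ?_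
  gcongr
  rw [Real.cosh_le_cosh, abs_of_nonneg dist_nonneg]
  exact h_dist.trans (le_abs_self _)

theorem exists_isometry_of_tendsto {ι : Type*} {l : Filter ι} [l.NeBot]
    {a : ι → HypThree → HypThree} (ha : ∀ i, Isometry (a i))
    {A : Mink →L[ℝ] Mink} (hA : Tendsto (fun i => linearize (a i)) l (𝓝 A)) :
    ∃ b : HypThree → HypThree, Isometry b ∧ ∀ p, (b p).hyperboloid = A p.hyperboloid := by
  have h_apply (x : Mink) : Tendsto (fun i => linearize (a i) x) l (𝓝 (A x)) :=
    hA.eval_const _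
  have h_form (x y : Mink) : lorentzForm (A x) (A y) = lorentzForm x y := by
    refine tendsto_nhds_unique ((continuous_lorentzForm.tendsto (A x, A y)).comp
      ((h_apply x).prodMk_nhds (h_apply y))) (tendsto_const_nhds.congr fun i => ?_)
    exact (lorentzForm_linearize (ha i) x y).symm
  have h_mem (p : HypThree) : ∃ q : HypThree, q.hyperboloid = A p.hyperboloid := by
    refine exists_hyperboloid_eq (by rw [h_form, lorentzForm_hyperboloid_self]) ?_
    refine ge_of_tendsto' ((continuous_fst.tendsto _).comp (h_apply p.hyperboloid)) fun i => ?_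
    rw [Function.comp_apply, linearize_hyperboloid (ha i)]
    exact mul_nonneg (inv_pos.2 (a i p).pos).le zero_le_one
  choose b hb using h_mem
  refine ⟨b, Isometry.of_dist_eq fun p q => ?_, hb⟩
  rw [dist_eq_dist_iff, hb, hb, h_form]

theorem exists_isometryEquiv_of_tendsto {ι : Type*} {l : Filter ι} [l.NeBot]
    {a : ι → HypThree ≃ᵢ HypThree} {A A' : Mink →L[ℝ] Mink}
    (hA : Tendsto (fun i => linearize (a i)) l (𝓝 A))
    (hA' : Tendsto (fun i => linearize ⇑(a i)⁻¹) l (𝓝 A')) :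
    ∃ b : HypThree ≃ᵢ HypThree, linearize b = A := by
  have h_left : A' * A = 1 := tendsto_nhds_unique (hA'.mul hA)
    (tendsto_const_nhds.congr fun i => (linearize_inv_mul_linearize (a i)).symm)
  have h_right : A * A' = 1 := tendsto_nhds_unique (hA.mul hA')
    (tendsto_const_nhds.congr fun i => (linearize_inv_mul_linearize (a i)⁻¹).symm)
  obtain ⟨b, hb, hbA⟩ := exists_isometry_of_tendsto (fun i => (a i).isometry) hA
  obtain ⟨b', -, hbA'⟩ := exists_isometry_of_tendsto (fun i => (a i)⁻¹.isometry) hA'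
  refine ⟨⟨⟨b, b', fun p => hyperboloid_injective ?_, fun p => hyperboloid_injective ?_⟩, hb⟩, ?_⟩
  · rw [hbA', hbA, ← mul_apply_eq_comp, h_left, one_apply_eq_self]
  · rw [hbA, hbA', ← mul_apply_eq_comp, h_right, one_apply_eq_self]
  · refine ContinuousLinearMap.coe_injective (frameBasis.ext fun i => ?_)
    rw [ContinuousLinearMap.coe_coe, ContinuousLinearMap.coe_coe, frameBasis_apply,
      linearize_frame]
    exact hbA (frame i)

theorem exists_subseq_linearize_tendsto {a : ℕ → HypThree ≃ᵢ HypThree} {R : ℝ}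
    (ha : ∀ n, dist (a n base) base ≤ R) : ∃ (b : HypThree ≃ᵢ HypThree) (s : ℕ → ℕ),
      StrictMono s ∧ Tendsto (fun n => linearize (a (s n))) atTop (𝓝 (linearize b)) := by
  have ha' (n : ℕ) : dist ((a n)⁻¹ base) base ≤ R := by
    rw [← (a n).dist_eq, IsometryEquiv.apply_inv_self, dist_comm]
    exact ha n
  obtain ⟨C, hC⟩ := exists_norm_linearize_le R
  obtain ⟨⟨A, A'⟩, -, s, hs, h⟩ := tendsto_subseq_of_bounded
    (Metric.isBounded_closedBall (x := (0 : (Mink →L[ℝ] Mink) × (Mink →L[ℝ] Mink))) (r := C))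
    (x := fun n => (linearize (a n), linearize ⇑(a n)⁻¹))
    fun n => mem_closedBall_zero_iff.2 (max_le (hC _ (ha n)) (hC _ (ha' n)))
  obtain ⟨b, rfl⟩ := exists_isometryEquiv_of_tendsto (a := fun n => a (s n)) h.fst_nhds h.snd_nhds
  exact ⟨b, s, hs, h.fst_nhds⟩

section

variable {ι : Type*} {l : Filter ι} {a : ι → HypThree ≃ᵢ HypThree} {b : HypThree ≃ᵢ HypThree}

theorem tendsto_apply_of_linearize (h : Tendsto (fun i => linearize (a i)) l (𝓝 (linearize b)))
    (p : HypThree) : Tendsto (fun i => a i p) l (𝓝 (b p)) := by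
  have h_form := (continuous_lorentzForm.tendsto (_, linearize b p.hyperboloid)).comp
    ((h.eval_const p.hyperboloid).prodMk_nhds tendsto_const_nhds)
  simp only [lorentzForm_linearize b.isometry, lorentzForm_hyperboloid_self] at h_form
  refine tendsto_of_lorentzForm_tendsto (h_form.congr fun i => ?_)
  simp only [Function.comp_apply, linearize_hyperboloid (a i).isometry,
    linearize_hyperboloid b.isometry]

theorem tendstoContinuously_of_linearize
    (h : Tendsto (fun i => linearize (a i)) l (𝓝 (linearize b))) :
    TendstoContinuously (fun i => a i) b l := by
  intro p
  have h_sum : Tendsto (fun x : ι × HypThree => dist x.2 p + dist (a x.1 p) (b p))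
      (l ×ˢ 𝓝 p) (𝓝 (0 + 0)) :=
    ((tendsto_iff_dist_tendsto_zero.1 tendsto_id).comp tendsto_snd).add
      ((tendsto_iff_dist_tendsto_zero.1 (tendsto_apply_of_linearize h p)).comp tendsto_fst)
  rw [add_zero] at h_sum
  refine tendsto_iff_dist_tendsto_zero.2 (squeeze_zero (fun _ => dist_nonneg) (fun x => ?_) h_sum)
  rw [← (a x.1).dist_eq x.2 p]
  exact dist_triangle _ _ _

theorem tendstoContinuously_boundaryHomeo
    (h : Tendsto (fun i => linearize (a i)) l (𝓝 (linearize b))) :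
    TendstoContinuously (fun i => boundaryHomeo (a i)) (boundaryHomeo b) l := by
  intro ξ
  rw [RSphere.isClosedEmbedding_toCone.isInducing.tendsto_nhds_iff, toCone_boundaryHomeo]
  have h_pair : Tendsto (fun x : ι × RSphere => (linearize (a x.1), x.2.toCone)) (l ×ˢ 𝓝 ξ)
      (𝓝 (linearize b, ξ.toCone)) :=
    (h.comp tendsto_fst).prodMk_nhds ((RSphere.continuous_toCone.tendsto ξ).comp tendsto_snd)
  have h_lin : Tendsto (fun x : ι × RSphere => linearize (a x.1) x.2.toCone) (l ×ˢ 𝓝 ξ)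
      (𝓝 (linearize b ξ.toCone)) :=
    ((continuous_fst.clm_apply continuous_snd).tendsto _).comp h_pair
  exact ((((minkTrace.continuous.tendsto _).comp h_lin).inv₀ (stretch_pos b ξ).ne').smul
    h_lin).congr fun x => (toCone_boundaryHomeo (a x.1) x.2).symm

end

end HypThree

/-! ### Renormalization of equivariant pairs -/

open HypThree

theorem IsNiceLattice.conj {Γ : Subgroup (HypThree ≃ᵢ HypThree)} (hΓ : IsNiceLattice Γ)
    (c : HypThree ≃ᵢ HypThree) : IsNiceLattice (Γ.map (MulAut.conj c).toMonoidHom) where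
  free := by
    rintro _ ⟨g, hg, rfl⟩ p hp
    have h_fix : g (c⁻¹ p) = c⁻¹ p := by
      apply c.injective
      rw [IsometryEquiv.apply_inv_self]
      exact hp
    rw [hΓ.free g hg _ h_fix, map_one]
  discontinuous := by
    intro K hK
    have hK' : IsCompact (c ⁻¹' K) := by
      rw [← IsometryEquiv.image_symm]
      exact hK.image c.symm.continuous
    refine ((hΓ.discontinuous _ hK').image (MulAut.conj c)).subset ?_
    rintro _ ⟨⟨g, hg, rfl⟩, x, ⟨y, hy, rfl⟩, hx⟩
    refine ⟨g, ⟨hg, g (c⁻¹ y), ⟨c⁻¹ y, ?_, rfl⟩, hx⟩, rfl⟩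
    simpa using hy
  cocompact := by
    obtain ⟨K, hK, h⟩ := hΓ.cocompact
    refine ⟨c '' K, hK.image c.continuous, fun p => ?_⟩
    obtain ⟨g, hg, hp⟩ := h (c⁻¹ p)
    exact ⟨_, ⟨g, hg, rfl⟩, ⟨_, hp, rfl⟩⟩

theorem mem_boundaryAction_iff {Γ : Subgroup (HypThree ≃ᵢ HypThree)} {φ : RSphere ≃ₜ RSphere} :
    φ ∈ boundaryAction Γ ↔ ∃ g ∈ Γ, φ = boundaryHomeo g :=
  exists_congr fun g => and_congr_right fun _ =>
    ⟨fun h => h.unique (isBoundaryExtension_boundaryHomeo g),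
      fun h => h ▸ isBoundaryExtension_boundaryHomeo g⟩

section

variable {H : Equiv.Perm HypThree} {h : RSphere ≃ₜ RSphere}

theorem IsBoundaryExtension.conj_boundaryHomeo_eq (hh : IsBoundaryExtension H h)
    {g g' : HypThree ≃ᵢ HypThree} (hg : H * g.toEquiv * H⁻¹ = g'.toEquiv) :
    h * boundaryHomeo g * h⁻¹ = boundaryHomeo g' := by
  rw [mul_inv_eq_iff_eq_mul] at hg ⊢
  have h_comp : H ∘ g = g' ∘ H := congrArg DFunLike.coe hg
  refine (hh.comp (isBoundaryExtension_boundaryHomeo g)).unique ?_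
  rw [h_comp]
  exact (isBoundaryExtension_boundaryHomeo g').comp hh

theorem IsBoundaryExtension.image_boundaryAction (hh : IsBoundaryExtension H h)
    {Γ₁ Γ₂ : Subgroup (HypThree ≃ᵢ HypThree)}
    (hΓ : (fun g : HypThree ≃ᵢ HypThree => H * g.toEquiv * H⁻¹) ''
      (Γ₁ : Set (HypThree ≃ᵢ HypThree)) = IsometryEquiv.toEquiv '' (Γ₂ : Set _)) :
    (fun φ : RSphere ≃ₜ RSphere => h * φ * h⁻¹) '' boundaryAction Γ₁ = boundaryAction Γ₂ := by
  apply Subset.antisymm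
  · rintro _ ⟨ψ, hψ, rfl⟩
    obtain ⟨g, hg, rfl⟩ := mem_boundaryAction_iff.1 hψ
    obtain ⟨g', hg', e⟩ := hΓ.subset (mem_image_of_mem _ hg)
    exact mem_boundaryAction_iff.2 ⟨g', hg', hh.conj_boundaryHomeo_eq e.symm⟩
  · intro φ hφ
    obtain ⟨g', hg', rfl⟩ := mem_boundaryAction_iff.1 hφ
    obtain ⟨g, hg, e⟩ := hΓ.superset (mem_image_of_mem _ hg')
    exact ⟨_, mem_boundaryAction_iff.2 ⟨g, hg, rfl⟩, hh.conj_boundaryHomeo_eq e⟩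

theorem image_conj_isometry_comp {Γ₁ Γ₂ : Subgroup (HypThree ≃ᵢ HypThree)}
    (hΓ : (fun g : HypThree ≃ᵢ HypThree => H * g.toEquiv * H⁻¹) ''
      (Γ₁ : Set (HypThree ≃ᵢ HypThree)) = IsometryEquiv.toEquiv '' (Γ₂ : Set _))
    (b a : HypThree ≃ᵢ HypThree) :
    (fun g : HypThree ≃ᵢ HypThree =>
        b.toEquiv * H * a.toEquiv * g.toEquiv * (b.toEquiv * H * a.toEquiv)⁻¹) ''
        (Γ₁.map (MulAut.conj a⁻¹).toMonoidHom : Set (HypThree ≃ᵢ HypThree)) =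
      IsometryEquiv.toEquiv '' (Γ₂.map (MulAut.conj b).toMonoidHom : Set _) := by
  have h_conj (g : HypThree ≃ᵢ HypThree) :
      b.toEquiv * H * a.toEquiv * (a.toEquiv⁻¹ * g.toEquiv * a.toEquiv) *
        (b.toEquiv * H * a.toEquiv)⁻¹ = b.toEquiv * (H * g.toEquiv * H⁻¹) * b.toEquiv⁻¹ := by
    group
  rw [Subgroup.coe_map, Subgroup.coe_map, image_image, image_image]
  calc _ = (fun x => b.toEquiv * x * b.toEquiv⁻¹) '' ((fun g : HypThree ≃ᵢ HypThree =>
        H * g.toEquiv * H⁻¹) '' (Γ₁ : Set (HypThree ≃ᵢ HypThree))) := by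
        rw [image_image]
        exact image_congr fun g _ => h_conj g
    _ = _ := by
        rw [hΓ, image_image]
        rfl

theorem IsBL.isometry_comp (hH : IsBL H) (b a : HypThree ≃ᵢ HypThree) :
    IsBL (b.toEquiv * H * a.toEquiv) := by
  obtain ⟨K, hK, hL⟩ := hH
  refine ⟨K, hK, fun p q => ?_⟩
  simpa only [Equiv.Perm.mul_apply, IsometryEquiv.coe_toEquiv, IsometryEquiv.dist_eq] using
    hL (a p) (a q)

theorem IsBL.continuous (hH : IsBL H) : Continuous H := by
  obtain ⟨K, -, hL⟩ := hH
  exact (LipschitzWith.of_dist_le' fun p q => (hL p q).2).continuous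

theorem IsEquivariantPair.isometry_comp (hH : IsEquivariantPair H h)
    (b a : HypThree ≃ᵢ HypThree) :
    IsEquivariantPair (b.toEquiv * H * a.toEquiv) (boundaryHomeo b * h * boundaryHomeo a) := by
  obtain ⟨hL, hh, Γ₁, Γ₂, hΓ₁, hΓ₂, hΓ, -⟩ := hH
  have hh' : IsBoundaryExtension (b.toEquiv * H * a.toEquiv : Equiv.Perm HypThree)
      (boundaryHomeo b * h * boundaryHomeo a) :=
    ((isBoundaryExtension_boundaryHomeo b).comp hh).comp (isBoundaryExtension_boundaryHomeo a)
  have hΓ' := image_conj_isometry_comp hΓ b a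
  exact ⟨hL.isometry_comp b a, hh', _, _, hΓ₁.conj a⁻¹, hΓ₂.conj b, hΓ',
    hh'.image_boundaryAction hΓ'⟩

theorem pairEquivalent_isometry_comp (H : Equiv.Perm HypThree) (h : RSphere ≃ₜ RSphere)
    (b a : HypThree ≃ᵢ HypThree) :
    PairEquivalent H h (b.toEquiv * H * a.toEquiv) (boundaryHomeo b * h * boundaryHomeo a) :=
  ⟨b, a, boundaryHomeo b, boundaryHomeo a, isBoundaryExtension_boundaryHomeo b,
    isBoundaryExtension_boundaryHomeo a, fun _ => rfl, fun _ => rfl⟩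

theorem PairEquivalent.trans {H' H'' : Equiv.Perm HypThree} {h' h'' : RSphere ≃ₜ RSphere}
    (h1 : PairEquivalent H h H' h') (h2 : PairEquivalent H' h' H'' h'') :
    PairEquivalent H h H'' h'' := by
  obtain ⟨f, g, φ, ψ, hf, hg, eH, eh⟩ := h1
  obtain ⟨f', g', φ', ψ', hf', hg', eH', eh'⟩ := h2
  refine ⟨f' * f, g * g', φ' * φ, ψ * ψ', hf'.comp hf, hg.comp hg', fun p => ?_, fun ξ => ?_⟩
  · rw [eH', eH]; rfl
  · rw [eh', eh]; rfl

/-- Since `H g = γ'⁻¹ H γ g` for every `γ` in the lattice and its partner `γ'`, cocompactness lets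
one trade `g` for an isometry moving the base point a bounded distance. -/
theorem IsEquivariantPair.exists_renormalization (hH : IsEquivariantPair H h) :
    ∃ R : ℝ, ∀ g : HypThree ≃ᵢ HypThree, ∃ a c : HypThree ≃ᵢ HypThree, dist (a base) base ≤ R ∧
      (∀ p, H (g p) = c (H (a p))) ∧
      ∀ ξ, h (boundaryHomeo g ξ) = boundaryHomeo c (h (boundaryHomeo a ξ)) := by
  obtain ⟨-, hh, Γ₁, Γ₂, hΓ₁, -, hΓ, -⟩ := hH
  obtain ⟨K, hK, hcov⟩ := hΓ₁.cocompact
  obtain ⟨R, hR⟩ := hK.isBounded.subset_closedBall base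
  refine ⟨R, fun g => ?_⟩
  obtain ⟨γ, hγ, hp⟩ := hcov (g base)
  obtain ⟨γ', -, eH⟩ := hΓ.subset (mem_image_of_mem _ hγ)
  have eh := hh.conj_boundaryHomeo_eq eH.symm
  rw [mul_inv_eq_iff_eq_mul] at eh
  replace eH := mul_inv_eq_iff_eq_mul.1 eH.symm
  refine ⟨γ * g, γ'⁻¹, hR hp, fun p => ?_, fun ξ => ?_⟩
  · exact ((IsometryEquiv.symm_apply_eq γ').2 (DFunLike.congr_fun eH (g p))).symm
  · rw [boundaryHomeo_mul, boundaryHomeo_inv]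
    exact ((Homeomorph.symm_apply_eq (boundaryHomeo γ')).2
      (DFunLike.congr_fun eh (boundaryHomeo g ξ))).symm

theorem dist_apply_base_le {K R B : ℝ} (hK : 0 ≤ K)
    (hL : ∀ p q, dist (H p) (H q) ≤ K * dist p q) {f a : HypThree ≃ᵢ HypThree}
    (ha : dist (a base) base ≤ R) (hf : dist (f (H (a base))) base ≤ B) :
    dist (f base) base ≤ dist base (H base) + K * R + B :=
  calc dist (f base) base
      ≤ dist base (H (a base)) + dist (f (H (a base))) base := by
        rw [← f.dist_eq base]
        exact dist_triangle _ _ _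
    _ ≤ dist base (H base) + dist (H (a base)) (H base) + B :=
        add_le_add (dist_triangle_right _ _ _) hf
    _ ≤ dist base (H base) + K * R + B := by
        gcongr
        exact (hL _ _).trans (by gcongr)

theorem IsEquivariantPair.exists_subseq_tendsto (hH : IsEquivariantPair H h)
    (f g : ℕ → HypThree ≃ᵢ HypThree)
    (htame : Bornology.IsBounded (range fun n => f n (H (g n base)))) :
    ∃ (b a : HypThree ≃ᵢ HypThree) (s : ℕ → ℕ), StrictMono s ∧
      TendstoContinuously (fun n p => f (s n) (H (g (s n) p)))
        (b.toEquiv * H * a.toEquiv : Equiv.Perm HypThree) atTop ∧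
      TendstoContinuously (fun n ξ => boundaryHomeo (f (s n)) (h (boundaryHomeo (g (s n)) ξ)))
        (boundaryHomeo b * h * boundaryHomeo a : RSphere ≃ₜ RSphere) atTop := by
  obtain ⟨R, hR⟩ := hH.exists_renormalization
  choose a c ha hcH hch using fun n => hR (g n)
  have eH (n : ℕ) (p : HypThree) : f n (H (g n p)) = (f n * c n) (H (a n p)) := by
    rw [hcH, IsometryEquiv.mul_apply]
  have eh (n : ℕ) (ξ : RSphere) : boundaryHomeo (f n) (h (boundaryHomeo (g n) ξ)) =
      boundaryHomeo (f n * c n) (h (boundaryHomeo (a n) ξ)) := by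
    rw [hch, boundaryHomeo_mul, Homeomorph.mul_apply]
  obtain ⟨K, hK, hL⟩ := hH.1
  obtain ⟨B, hB⟩ := htame.subset_closedBall base
  have hfc (n : ℕ) : dist ((f n * c n) base) base ≤ dist base (H base) + K * R + B :=
    dist_apply_base_le (zero_le_one.trans hK) (fun p q => (hL p q).2) (ha n) (by
      rw [← eH]
      exact hB ⟨n, rfl⟩)
  obtain ⟨a', s, hs, ha'⟩ := exists_subseq_linearize_tendsto ha
  obtain ⟨b', s', hs', hb'⟩ := exists_subseq_linearize_tendsto fun n => hfc (s n)
  replace ha' := ha'.comp hs'.tendsto_atTop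
  refine ⟨b', a', s ∘ s', hs.comp hs', ?_, ?_⟩
  · simp only [Function.comp_apply, eH]
    exact ((tendstoContinuously_of_linearize hb').comp
      (.const hH.1.continuous atTop)).comp (tendstoContinuously_of_linearize ha')
  · simp only [Function.comp_apply, eh]
    exact ((tendstoContinuously_boundaryHomeo hb').comp
      (.const h.continuous atTop)).comp (tendstoContinuously_boundaryHomeo ha')

end

/-- The orientation preserving affine homeomorphism `z ↦ a z + b`. -/
noncomputable def affineHomeo (a b : ℂ) (ha : a ≠ 0) : ℂ ≃ₜ ℂ :=
  (Homeomorph.mulLeft₀ a ha).trans (Homeomorph.addRight b)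

namespace HypThree

/-- The similarity `(z, t) ↦ (a z + b, |a| t)`. -/
noncomputable def similarity (a b : ℂ) (ha : a ≠ 0) : HypThree ≃ᵢ HypThree where
  toFun p := ⟨a * p.z + b, ‖a‖ * p.t, mul_pos (norm_pos_iff.2 ha) p.pos⟩
  invFun p := ⟨a⁻¹ * (p.z - b), ‖a‖⁻¹ * p.t, mul_pos (inv_pos.2 (norm_pos_iff.2 ha)) p.pos⟩
  left_inv p := by ext <;> simp [ha]
  right_inv p := by ext <;> simp [ha]
  isometry_toFun := by
    refine Isometry.of_dist_eq fun p q => dist_eq_dist_iff.2 ?_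
    have hp := p.pos
    have hq := q.pos
    have := norm_pos_iff.2 ha
    simp only [hyperboloid, map_smul, LinearMap.smul_apply, lorentzForm_paraboloid, smul_eq_mul,
      add_sub_add_right_eq_sub, ← mul_sub, norm_mul]
    field_simp

theorem isBoundaryExtension_similarity (a b : ℂ) (ha : a ≠ 0) :
    IsBoundaryExtension (similarity a b ha) (affineHomeo a b ha).onePointCongr := by
  intro ξ
  let G : ℂ × ℝ ≃ₜ ℂ × ℝ := (affineHomeo a b ha).prodCongr
    (Homeomorph.mulLeft₀ ‖a‖ (norm_ne_zero_iff.2 ha))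
  have hG : RSphere.toBall ((affineHomeo a b ha).onePointCongr ξ) = G.onePointCongr ξ.toBall := by
    induction ξ using OnePoint.rec with
    | infty => rfl
    | coe z => exact congrArg OnePoint.some (Prod.ext rfl (mul_zero ‖a‖).symm)
  rw [hG]
  exact (G.onePointCongr.continuous.tendsto _).comp tendsto_comap

theorem boundaryHomeo_similarity (a b : ℂ) (ha : a ≠ 0) :
    boundaryHomeo (similarity a b ha) = (affineHomeo a b ha).onePointCongr :=
  (isBoundaryExtension_boundaryHomeo _).unique (isBoundaryExtension_similarity a b ha)

theorem boundaryHomeo_similarity_coe (a b : ℂ) (ha : a ≠ 0) (z : ℂ) :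
    boundaryHomeo (similarity a b ha) (z : OnePoint ℂ) = ((a * z + b : ℂ) : OnePoint ℂ) := by
  rw [boundaryHomeo_similarity]; rfl

theorem boundaryHomeo_similarity_infty (a b : ℂ) (ha : a ≠ 0) :
    boundaryHomeo (similarity a b ha) OnePoint.infty = OnePoint.infty := by
  rw [boundaryHomeo_similarity]; rfl

end HypThree

namespace RSphere

/-- A family of ideal points is `ε`-separated if `ε` bounds its squared chordal distances from
below. -/
def IsSeparated {ι : Type*} (ε : ℝ) (T : ι → RSphere) : Prop :=
  Pairwise fun i j => ε ≤ sqChord (T i) (T j)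

theorem IsSeparated.mono {ι : Type*} {ε δ : ℝ} {T : ι → RSphere} (hT : IsSeparated ε T)
    (h : δ ≤ ε) : IsSeparated δ T :=
  fun _ _ hij => h.trans (hT hij)

theorem exists_forall_le_sqChord_of_tendsto {ξ η : ℕ → RSphere} {ξ' η' : RSphere}
    (hξ : Tendsto ξ atTop (𝓝 ξ')) (hη : Tendsto η atTop (𝓝 η')) (hne : ∀ n, ξ n ≠ η n)
    (hne' : ξ' ≠ η') : ∃ ε > 0, ∀ n, ε ≤ sqChord (ξ n) (η n) := by
  obtain ⟨ε, hε, h⟩ := (hξ.prodMk_nhds hη).isCompact_insert_range.exists_forall_le' (a := 0)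
    continuous_sqChord.continuousOn (by
      rintro _ (rfl | ⟨n, rfl⟩)
      exacts [sqChord_pos hne', sqChord_pos (hne n)])
  exact ⟨ε, hε, fun n => h _ (mem_insert_of_mem _ (mem_range_self n))⟩

theorem exists_isSeparated_of_tendsto {ι : Type*} [Finite ι] {T : ℕ → ι → RSphere}
    {T' : ι → RSphere} (h : Tendsto T atTop (𝓝 T')) (hT : ∀ n, Function.Injective (T n))
    (hT' : Function.Injective T') : ∃ ε > 0, ∀ n, IsSeparated ε (T n) := by
  have h_pair : ∀ᶠ ε : ℝ in 𝓝[>] 0, ∀ i j, i ≠ j → ∀ n, ε ≤ sqChord (T n i) (T n j) := by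
    simp only [eventually_all]
    intro i j hij
    obtain ⟨δ, hδ, hle⟩ := exists_forall_le_sqChord_of_tendsto (h.apply_nhds i) (h.apply_nhds j)
      (fun n => (hT n).ne hij) (hT'.ne hij)
    filter_upwards [Ioc_mem_nhdsGT hδ] with ε hε n
    exact hε.2.trans (hle n)
  obtain ⟨ε, hle, hε⟩ := (h_pair.and self_mem_nhdsWithin).exists
  exact ⟨ε, hε, fun n i j hij => hle i j hij n⟩

theorem exists_isSeparated {ι : Type*} [Finite ι] {T : ι → RSphere} (hT : Function.Injective T) :
    ∃ ε > 0, IsSeparated ε T := by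
  obtain ⟨ε, hε, h⟩ := exists_isSeparated_of_tendsto tendsto_const_nhds (fun _ => hT) hT
  exact ⟨ε, hε, h 0⟩

theorem exists_forall_le_sqChord_map {k : RSphere → RSphere} (hk : Continuous k)
    (hk' : Function.Injective k) {δ : ℝ} (hδ : 0 < δ) :
    ∃ ε > 0, ∀ ξ η, δ ≤ sqChord ξ η → ε ≤ sqChord (k ξ) (k η) := by
  have h_compact : IsCompact {p : RSphere × RSphere | δ ≤ sqChord p.1 p.2} :=
    (isClosed_le continuous_const continuous_sqChord).isCompact
  have h_ne {ξ η : RSphere} (h : δ ≤ sqChord ξ η) : ξ ≠ η := by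
    rintro rfl
    exact (hδ.trans_le h).ne' (sqChord_self ξ)
  obtain ⟨ε, hε, h⟩ := h_compact.exists_forall_le' (a := 0)
    (continuous_sqChord.comp (hk.prodMap hk)).continuousOn
    fun p hp => sqChord_pos (hk'.ne (h_ne hp))
  exact ⟨ε, hε, fun ξ η hξη => h (ξ, η) hξη⟩

end RSphere

namespace HypThree

open RSphere

theorem dist_inv_base (a : HypThree ≃ᵢ HypThree) : dist (a⁻¹ base) base = dist (a base) base := by
  rw [← a.dist_eq, IsometryEquiv.apply_inv_self, dist_comm]

theorem stretch_le (a : HypThree ≃ᵢ HypThree) (ξ : RSphere) :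
    stretch a ξ ≤ 2 * Real.cosh (dist (a base) base) := by
  have h := lorentzForm_le_minkTrace_mul (RSphere.lorentzForm_toCone_self ξ).ge
    ((lorentzForm_hyperboloid_self (a⁻¹ base)).symm ▸ zero_le_one)
    (one_pos.trans_eq (minkTrace_toCone ξ).symm) (minkTrace_hyperboloid_pos _)
  rw [minkTrace_toCone, minkTrace_hyperboloid, dist_inv_base] at h
  rw [stretch_eq]
  linarith

theorem two_mul_sqChord_mul_cosh_le (a : HypThree ≃ᵢ HypThree) (ξ η : RSphere) :
    2 * sqChord ξ η * Real.cosh (dist (a base) base) ≤ stretch a ξ + stretch a η := by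
  have h := sqChord_mul_minkTrace_le ξ η (a⁻¹ base)
  rw [minkTrace_hyperboloid, dist_inv_base] at h
  rw [stretch_eq, stretch_eq]
  linarith

theorem div_le_sqChord_boundaryHomeo (a : HypThree ≃ᵢ HypThree) {ξ η : RSphere} {δ R : ℝ}
    (hδ : 0 ≤ δ) (h : δ ≤ sqChord ξ η) (ha : dist (a base) base ≤ R) :
    δ / (2 * Real.cosh R) ^ 2 ≤ sqChord (boundaryHomeo a ξ) (boundaryHomeo a η) := by
  have h_stretch (ξ : RSphere) : stretch a ξ ≤ 2 * Real.cosh R :=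
    (stretch_le a ξ).trans <| mul_le_mul_of_nonneg_left
      (Real.cosh_le_cosh.2 (abs_le_abs_of_nonneg dist_nonneg ha)) zero_le_two
  have hξ := stretch_pos a ξ
  have hη := stretch_pos a η
  rw [sqChord_boundaryHomeo, sq]
  gcongr
  exacts [hδ.trans h, h_stretch ξ, h_stretch η]

theorem exists_forall_le_sqChord_boundaryHomeo (k : RSphere ≃ₜ RSphere) (R : ℝ) {δ : ℝ}
    (hδ : 0 < δ) : ∃ ε > 0, ∀ a : HypThree ≃ᵢ HypThree, dist (a base) base ≤ R → ∀ ξ η,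
      δ ≤ sqChord ξ η → ε ≤ sqChord (k (boundaryHomeo a ξ)) (k (boundaryHomeo a η)) := by
  have := Real.cosh_pos R
  obtain ⟨ε, hε, h⟩ := exists_forall_le_sqChord_map k.continuous k.injective
    (δ := δ / (2 * Real.cosh R) ^ 2) (by positivity)
  exact ⟨ε, hε, fun a ha ξ η hξη => h _ _ (div_le_sqChord_boundaryHomeo a hδ.le hξη ha)⟩

theorem stretch_sq_le {b : HypThree ≃ᵢ HypThree} {ε : ℝ} (hε : 0 < ε) {ξ η ζ : RSphere}
    (hξη : ε ≤ sqChord (boundaryHomeo b ξ) (boundaryHomeo b η))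
    (hξζ : ε ≤ sqChord (boundaryHomeo b ξ) (boundaryHomeo b ζ)) (hηζ : ε ≤ sqChord η ζ) :
    stretch b ξ ^ 2 ≤ ((2 * ε)⁻¹) ^ 3 := by
  have hξ := stretch_pos b ξ
  have hη := stretch_pos b η
  have hζ := stretch_pos b ζ
  have h_upper {α β : RSphere} (h : ε ≤ sqChord (boundaryHomeo b α) (boundaryHomeo b β)) :
      stretch b α * stretch b β ≤ (2 * ε)⁻¹ := by
    rw [sqChord_boundaryHomeo, le_div_iff₀ (mul_pos (stretch_pos b α) (stretch_pos b β))] at h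
    rw [← one_div, le_div_iff₀ (by positivity)]
    linarith [sqChord_le_half α β]
  have h_lower : 2 * ε ≤ stretch b η * stretch b ζ := by
    have h := sqChord_le_half (boundaryHomeo b η) (boundaryHomeo b ζ)
    rw [sqChord_boundaryHomeo, div_le_iff₀ (mul_pos hη hζ)] at h
    linarith
  calc stretch b ξ ^ 2
      = (stretch b ξ * stretch b η) * (stretch b ξ * stretch b ζ) *
          (stretch b η * stretch b ζ)⁻¹ := by field_simp
    _ ≤ (2 * ε)⁻¹ * (2 * ε)⁻¹ * (2 * ε)⁻¹ := by
        gcongr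
        exacts [h_upper hξη, h_upper hξζ]
    _ = _ := by ring

/-- Three ideal points are needed: a loxodromic isometry fixes two. -/
theorem exists_dist_base_le {ε : ℝ} (hε : 0 < ε) : ∃ R : ℝ, ∀ (b : HypThree ≃ᵢ HypThree)
    (T : Fin 3 → RSphere), IsSeparated ε T → IsSeparated ε (boundaryHomeo b ∘ T) →
      dist (b base) base ≤ R := by
  refine ⟨√(((2 * ε)⁻¹) ^ 3) / ε, fun b T hT hbT => ?_⟩
  have h₀ : stretch b (T 0) ≤ √(((2 * ε)⁻¹) ^ 3) :=
    Real.le_sqrt_of_sq_le (stretch_sq_le hε (hbT (i := 0) (j := 1) (by decide))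
      (hbT (i := 0) (j := 2) (by decide)) (hT (by decide)))
  have h₁ : stretch b (T 1) ≤ √(((2 * ε)⁻¹) ^ 3) :=
    Real.le_sqrt_of_sq_le (stretch_sq_le hε (hbT (i := 1) (j := 0) (by decide))
      (hbT (i := 1) (j := 2) (by decide)) (hT (by decide)))
  have h_cosh : dist (b base) base ≤ Real.cosh (dist (b base) base) :=
    (Real.self_le_sinh_iff.2 dist_nonneg).trans (Real.sinh_lt_cosh _).le
  have hT01 : ε ≤ sqChord (T 0) (T 1) := hT (by decide)
  rw [le_div_iff₀ hε]
  nlinarith [two_mul_sqChord_mul_cosh_le b (T 0) (T 1), Real.cosh_pos (dist (b base) base)]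

theorem cross_ratio_boundaryHomeo (c : HypThree ≃ᵢ HypThree) (p q r s : RSphere) :
    sqChord (boundaryHomeo c p) (boundaryHomeo c q) *
        sqChord (boundaryHomeo c r) (boundaryHomeo c s) * (sqChord p s * sqChord r q) =
      sqChord (boundaryHomeo c p) (boundaryHomeo c s) *
        sqChord (boundaryHomeo c r) (boundaryHomeo c q) * (sqChord p q * sqChord r s) := by
  have hp := stretch_pos c p
  have hq := stretch_pos c q
  have hr := stretch_pos c r
  have hs := stretch_pos c s
  simp only [sqChord_boundaryHomeo]
  field_simp

theorem norm_sub_le_of_boundaryHomeo_eq {c : HypThree ≃ᵢ HypThree} {p q r s : RSphere}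
    {x y x' : ℂ} (hp : boundaryHomeo c p = x) (hq : boundaryHomeo c q = y)
    (hr : boundaryHomeo c r = x') (hs : boundaryHomeo c s = OnePoint.infty) {ε : ℝ} (hε : 0 < ε)
    (hps : ε ≤ sqChord p s) (hrq : ε ≤ sqChord r q) : ‖x - y‖ ≤ (2 * ε)⁻¹ * ‖x' - y‖ := by
  have h_cross : ‖x - y‖ ^ 2 * (sqChord p s * sqChord r q) =
      ‖x' - y‖ ^ 2 * (sqChord p q * sqChord r s) := by
    have hx := sqChord_pos (OnePoint.coe_ne_infty x)
    have hy := sqChord_pos (OnePoint.coe_ne_infty y)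
    have hx' := sqChord_pos (OnePoint.coe_ne_infty x')
    have h := cross_ratio_boundaryHomeo c p q r s
    rw [hp, hq, hr, hs, sqChord_coe_eq_mul x y, sqChord_coe_eq_mul x' y] at h
    refine mul_left_cancel₀ (mul_pos (mul_pos hx hy) hx').ne' ?_
    linarith
  have h_sq : (‖x - y‖ * ε) ^ 2 ≤ (‖x' - y‖ * (1 / 2)) ^ 2 :=
    calc (‖x - y‖ * ε) ^ 2 = ‖x - y‖ ^ 2 * (ε * ε) := by ring
      _ ≤ ‖x - y‖ ^ 2 * (sqChord p s * sqChord r q) := by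
        gcongr
        exact hε.le.trans hps
      _ = ‖x' - y‖ ^ 2 * (sqChord p q * sqChord r s) := h_cross
      _ ≤ ‖x' - y‖ ^ 2 * (1 / 2 * (1 / 2)) := by
        gcongr
        exacts [sqChord_nonneg r s, sqChord_le_half p q, sqChord_le_half r s]
      _ = (‖x' - y‖ * (1 / 2)) ^ 2 := by ring
  have h_le := le_of_sq_le_sq h_sq (by positivity)
  rw [inv_mul_eq_div, le_div_iff₀ (by positivity)]
  linarith

end HypThree

/-! ### Quasisymmetry of the boundary map -/

theorem exists_continuous_coe_eq {k : RSphere → RSphere} (hk : Continuous k)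
    (hk' : ∀ z : ℂ, k z ≠ OnePoint.infty) :
    ∃ f : ℂ → ℂ, Continuous f ∧ ∀ z : ℂ, (f z : RSphere) = k z := by
  choose f hf using fun z : ℂ => OnePoint.ne_infty_iff_exists.1 (hk' z)
  refine ⟨f, ?_, hf⟩
  rw [OnePoint.isOpenEmbedding_coe.isInducing.continuous_iff]
  exact (hk.comp OnePoint.continuous_coe).congr fun z => (hf z).symm

theorem exists_onePointCongr_eq {k : RSphere ≃ₜ RSphere} (hk : k OnePoint.infty = OnePoint.infty) :
    ∃ h : ℂ ≃ₜ ℂ, h.onePointCongr = k := by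
  have h_symm : k.symm OnePoint.infty = OnePoint.infty := k.symm_apply_eq.2 hk.symm
  obtain ⟨f, hf, hfk⟩ := exists_continuous_coe_eq k.continuous fun z =>
    hk ▸ k.injective.ne (OnePoint.coe_ne_infty z)
  obtain ⟨g, hg, hgk⟩ := exists_continuous_coe_eq k.symm.continuous fun z h =>
    OnePoint.coe_ne_infty z (k.symm.injective (h.trans h_symm.symm))
  refine ⟨⟨⟨f, g, fun z => ?_, fun z => ?_⟩, hf, hg⟩, ?_⟩
  · apply OnePoint.coe_injective
    rw [hgk, hfk, Homeomorph.symm_apply_apply]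
  · apply OnePoint.coe_injective
    rw [hfk, hgk, Homeomorph.apply_symm_apply]
  · ext ξ
    induction ξ using OnePoint.rec with
    | infty => exact hk.symm
    | coe z => exact hfk z

theorem onePointCongr_coe (h : ℂ ≃ₜ ℂ) (z : ℂ) : h.onePointCongr (z : RSphere) = h z := rfl

theorem onePointCongr_infty (h : ℂ ≃ₜ ℂ) : h.onePointCongr OnePoint.infty = OnePoint.infty := rfl

/-- Quasisymmetry with distortion function `η`. Monotonicity and continuity of `η` are not part of
the definition. -/
def IsQuasisymmetric {X Y : Type*} [MetricSpace X] [MetricSpace Y] (η : NNReal → NNReal)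
    (f : X → Y) : Prop :=
  ∀ (t : NNReal) (x y z : X), dist y x ≤ t * dist z x → dist (f y) (f x) ≤ η t * dist (f z) (f x)

theorem IsQuasisymmetric.comp {X Y Z : Type*} [MetricSpace X] [MetricSpace Y] [MetricSpace Z]
    {η : NNReal → NNReal} {f : Y → Z} {g : X → Y} {K₁ K₂ : NNReal} (hf : IsQuasisymmetric η f)
    (hg₁ : LipschitzWith K₁ g) (hg₂ : AntilipschitzWith K₂ g) :
    IsQuasisymmetric (fun t => η (K₁ * t * K₂)) (f ∘ g) := by
  intro t x y z h
  refine hf _ _ _ _ ?_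
  calc dist (g y) (g x) ≤ K₁ * dist y x := hg₁.dist_le_mul y x
    _ ≤ K₁ * (t * (K₂ * dist (g z) (g x))) := by
        gcongr
        exact h.trans (mul_le_mul_of_nonneg_left (hg₂.le_mul_dist z x) t.coe_nonneg)
    _ = ↑(K₁ * t * K₂) * dist (g z) (g x) := by
        push_cast
        ring

open RSphere

theorem IsEquivariantPair.exists_isQuasisymmetric {H : Equiv.Perm HypThree} {h : ℂ ≃ₜ ℂ}
    (hH : IsEquivariantPair H h.onePointCongr) : ∃ η, IsQuasisymmetric η h := by
  obtain ⟨R, hR⟩ := hH.exists_renormalization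
  have h_pos (t : NNReal) : 0 < min (1 / 4 : ℝ) (1 / (2 * (1 + (t : ℝ) ^ 2))) := by positivity
  choose ε hε hsep using fun t =>
    exists_forall_le_sqChord_boundaryHomeo h.onePointCongr R (h_pos t)
  refine ⟨fun t => (2 * (ε t))⁻¹.toNNReal, fun t x y z hyz => ?_⟩
  rw [Real.coe_toNNReal _ (inv_nonneg.2 (mul_pos two_pos (hε t)).le)]
  obtain rfl | hzx := eq_or_ne z x
  · rw [dist_self, mul_zero, dist_le_zero] at hyz
    simp [hyz]
  replace hzx := sub_ne_zero.2 hzx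
  obtain ⟨a, c, ha, -, hc⟩ := hR (similarity (z - x) x hzx)
  have h_coe (w : ℂ) : boundaryHomeo c (h.onePointCongr (boundaryHomeo a w)) =
      (h ((z - x) * w + x) : RSphere) := by
    rw [← hc, boundaryHomeo_similarity_coe, onePointCongr_coe]
  have h_infty : boundaryHomeo c (h.onePointCongr (boundaryHomeo a OnePoint.infty)) =
      OnePoint.infty := by
    rw [← hc, boundaryHomeo_similarity_infty, onePointCongr_infty]
  have hy := h_coe ((y - x) / (z - x))
  have hx := h_coe 0
  have hz := h_coe 1
  rw [mul_div_cancel₀ _ hzx, sub_add_cancel] at hy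
  rw [mul_zero, zero_add] at hx
  rw [mul_one, sub_add_cancel] at hz
  rw [dist_eq_norm, dist_eq_norm]
  refine norm_sub_le_of_boundaryHomeo_eq hy hx hz h_infty (hε t) (hsep t a ha _ _ ?_)
    (hsep t a ha _ _ ?_)
  · have h_le : ‖(y - x) / (z - x)‖ ≤ t := by
      rwa [norm_div, div_le_iff₀ (norm_pos_iff.2 hzx), ← dist_eq_norm, ← dist_eq_norm]
    rw [sqChord_coe_infty]
    refine (min_le_right _ _).trans ?_
    gcongr
  · refine (min_le_left _ _).trans ?_
    rw [sqChord_coe]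
    norm_num

theorem IsBL.exists_forall_dist_base_le {H : Equiv.Perm HypThree} (hH : IsBL H) (R : ℝ)
    (p : HypThree) :
    ∃ ρ, ∀ a : HypThree ≃ᵢ HypThree, dist (a base) base ≤ R → dist (H (a p)) base ≤ ρ := by
  obtain ⟨K, hK, hL⟩ := hH
  refine ⟨K * (dist p base + R) + dist (H base) base, fun a ha => ?_⟩
  calc dist (H (a p)) base
      ≤ dist (H (a p)) (H base) + dist (H base) base := dist_triangle _ _ _
    _ ≤ K * (dist (a p) (a base) + dist (a base) base) + dist (H base) base := by
        gcongr
        refine (hL _ _).2.trans ?_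
        gcongr
        exact dist_triangle _ _ _
    _ ≤ K * (dist p base + R) + dist (H base) base := by
        rw [IsometryEquiv.dist_eq]
        gcongr

theorem IsEquivariantPair.isBounded_range_of_tendsto {H : Equiv.Perm HypThree}
    {h : RSphere ≃ₜ RSphere} (hH : IsEquivariantPair H h) {f g : ℕ → HypThree ≃ᵢ HypThree}
    {T T' : Fin 3 → RSphere} (hT : Function.Injective T) (hT' : Function.Injective T')
    (hlim : Tendsto (fun n i => boundaryHomeo (f n) (h (boundaryHomeo (g n) (T i)))) atTop (𝓝 T'))
    (p : HypThree) : Bornology.IsBounded (range fun n => f n (H (g n p))) := by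
  obtain ⟨R, hR⟩ := hH.exists_renormalization
  choose a c ha hcH hch using fun n => hR (g n)
  obtain ⟨ρ, hρ⟩ := hH.1.exists_forall_dist_base_le R p
  obtain ⟨δ, hδ, hδT⟩ := exists_isSeparated hT
  obtain ⟨ε₁, hε₁, hsep⟩ := exists_forall_le_sqChord_boundaryHomeo h R hδ
  obtain ⟨ε₂, hε₂, hlim_sep⟩ := exists_isSeparated_of_tendsto hlim
    (fun n => (boundaryHomeo (f n)).injective.comp (h.injective.comp
      ((boundaryHomeo (g n)).injective.comp hT))) hT'
  obtain ⟨R', hR'⟩ := exists_dist_base_le (lt_min hε₁ hε₂)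
  have hfc (n : ℕ) : dist (f n (c n base)) base ≤ R' := by
    refine hR' (f n * c n) (fun i => h (boundaryHomeo (a n) (T i)))
      (fun i j hij => (min_le_left _ _).trans (hsep _ (ha n) _ _ (hδT hij))) ?_
    refine IsSeparated.mono (fun i j hij => ?_) (min_le_right _ _)
    simp only [Function.comp_apply, boundaryHomeo_mul, Homeomorph.mul_apply, ← hch]
    exact hlim_sep n hij
  rw [Metric.isBounded_iff_subset_closedBall base]
  refine ⟨ρ + R', ?_⟩
  rintro _ ⟨n, rfl⟩
  calc dist (f n (H (g n p))) base
      ≤ dist (f n (H (g n p))) (f n (c n base)) + dist (f n (c n base)) base :=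
        dist_triangle _ _ _
    _ ≤ ρ + R' := by
        rw [hcH, IsometryEquiv.dist_eq, IsometryEquiv.dist_eq]
        exact add_le_add (hρ _ (ha n)) (hfc n)

theorem homothety_eq_similarity (c : ℂ) (r : ℝ) (hr : 0 < r) (p : HypThree) :
    homothety c r hr p = similarity r (c - r * c) (Complex.ofReal_ne_zero.2 hr.ne') p := by
  refine HypThree.ext ?_ ?_
  · change AffineMap.homothety c r p.z = r * p.z + (c - r * c)
    rw [AffineMap.homothety_apply, vsub_eq_sub, vadd_eq_add, Complex.real_smul]
    ring
  · change r * p.t = ‖(r : ℂ)‖ * p.t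
    rw [Complex.norm_real, Real.norm_of_nonneg hr.le]

/-- The isometries `g_m`, `m = n + 1`, of the zoom sequences based at `z`. -/
noncomputable def zoomIn (z : ℂ) (n : ℕ) : HypThree ≃ᵢ HypThree :=
  similarity ((1 / (n + 1) : ℝ) : ℂ) (z - ((1 / (n + 1) : ℝ) : ℂ) * z)
    (Complex.ofReal_ne_zero.2 (one_div_pos.2 n.cast_add_one_pos).ne')

/-- The isometries `f_m`, `m = n + 1`, of the zoom sequences with image base point `z`. -/
noncomputable def zoomOut (z : ℂ) (n : ℕ) : HypThree ≃ᵢ HypThree :=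
  similarity ((n + 1 : ℝ) : ℂ) (z - ((n + 1 : ℝ) : ℂ) * z)
    (Complex.ofReal_ne_zero.2 n.cast_add_one_pos.ne')

theorem zoomHyp_eq (H : Equiv.Perm HypThree) (h : ℂ ≃ₜ ℂ) (z : ℂ) (n : ℕ) (p : HypThree) :
    zoomHyp H h z n p = zoomOut (h z) n (H (zoomIn z n p)) := by
  rw [zoomHyp, homothety_eq_similarity, homothety_eq_similarity]
  rfl

theorem zoomPlane_eq (h : ℂ ≃ₜ ℂ) (z : ℂ) (n : ℕ) (u : ℂ) :
    zoomPlane h z n u =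
      ((n : ℝ) + 1) • (h (z + (1 / ((n : ℝ) + 1)) • (u - z)) - h z) + h z := by
  simp only [zoomPlane, AffineMap.homothety_apply, vsub_eq_sub, vadd_eq_add, add_comm]

theorem zoomPlane_self (h : ℂ ≃ₜ ℂ) (z : ℂ) (n : ℕ) : zoomPlane h z n z = h z := by
  simp only [zoomPlane, AffineMap.homothety_apply_same]

theorem onePoint_map_zoomPlane (h : ℂ ≃ₜ ℂ) (z : ℂ) (n : ℕ) (ξ : RSphere) :
    OnePoint.map (zoomPlane h z n) ξ =
      boundaryHomeo (zoomOut (h z) n) (h.onePointCongr (boundaryHomeo (zoomIn z n) ξ)) := by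
  induction ξ using OnePoint.rec with
  | infty =>
    rw [zoomIn, boundaryHomeo_similarity_infty, onePointCongr_infty, zoomOut,
      boundaryHomeo_similarity_infty, OnePoint.map_infty]
  | coe u =>
    rw [zoomIn, boundaryHomeo_similarity_coe, onePointCongr_coe, zoomOut,
      boundaryHomeo_similarity_coe, OnePoint.map_some, zoomPlane_eq]
    have h_arg : z + (1 / ((n : ℝ) + 1)) • (u - z) =
        ((1 / (n + 1) : ℝ) : ℂ) * u + (z - ((1 / (n + 1) : ℝ) : ℂ) * z) := by
      rw [Complex.real_smul]
      ring
    rw [h_arg, Complex.real_smul]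
    congr 1
    ring

theorem IsEquivariantPair.isTame {H : Equiv.Perm HypThree} {h : ℂ ≃ₜ ℂ}
    (hH : IsEquivariantPair H h.onePointCongr) {z v w : ℂ} (hv : v ≠ 0) (hw : w ≠ 0)
    (hlim : Tendsto (fun n : ℕ => zoomPlane h z n (z + v)) atTop (𝓝 (h z + w))) :
    IsTame (zoomHyp H h z) := by
  have h_inj {x y : ℂ} (hy : y ≠ 0) :
      Function.Injective ![(x : RSphere), ((x + y : ℂ) : RSphere), OnePoint.infty] := by
    intro i j
    fin_cases i <;> fin_cases j <;> simp [hy]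
  have h_tendsto : Tendsto (fun n i => OnePoint.map (zoomPlane h z n)
      (![(z : RSphere), ((z + v : ℂ) : RSphere), OnePoint.infty] i)) atTop
      (𝓝 ![(h z : RSphere), ((h z + w : ℂ) : RSphere), OnePoint.infty]) := by
    rw [tendsto_pi_nhds]
    intro i
    fin_cases i
    · simp [zoomPlane_self]
    · exact (OnePoint.continuous_coe.tendsto _).comp hlim
    · simp
  intro p
  simp only [zoomHyp_eq]
  simp only [onePoint_map_zoomPlane] at h_tendsto
  exact hH.isBounded_range_of_tendsto (h_inj hv) (h_inj hw) h_tendsto p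

theorem TendstoContinuously.of_onePoint_map {F : ℕ → ℂ → ℂ} {f : ℂ ≃ₜ ℂ}
    (h : TendstoContinuously (fun n => OnePoint.map (F n)) f.onePointCongr atTop) :
    TendstoContinuously F f atTop := by
  intro x
  rw [OnePoint.isOpenEmbedding_coe.isInducing.tendsto_nhds_iff]
  have hx := h (x : RSphere)
  rw [OnePoint.nhds_coe_eq] at hx
  exact hx.comp (tendsto_fst.prodMk (tendsto_map.comp tendsto_snd))

theorem IsEquivariantPair.exists_zoomsTo {H : Equiv.Perm HypThree} {h : ℂ ≃ₜ ℂ}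
    (hH : IsEquivariantPair H h.onePointCongr) {z v w : ℂ} (hv : v ≠ 0) (hw : w ≠ 0)
    (hlim : Tendsto (fun n : ℕ => zoomPlane h z n (z + v)) atTop (𝓝 (h z + w))) :
    ∃ (H' : Equiv.Perm HypThree) (h' : ℂ ≃ₜ ℂ) (s : ℕ → ℕ), StrictMono s ∧
      ZoomsTo H h H' h' ∧ IsEquivariantPair H' h'.onePointCongr ∧
      PairEquivalent H h.onePointCongr H' h'.onePointCongr ∧
      TendstoContinuously (fun n => zoomPlane h z (s n)) h' atTop := by
  have htame := hH.isTame hv hw hlim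
  obtain ⟨b, a, s, hs, hlimH, hlimh⟩ := hH.exists_subseq_tendsto (zoomOut (h z)) (zoomIn z) (by
    simpa only [zoomHyp_eq] using htame base)
  simp only [← zoomHyp_eq] at hlimH
  simp only [← onePoint_map_zoomPlane] at hlimh
  obtain ⟨h', hh'⟩ := exists_onePointCongr_eq
    (k := boundaryHomeo b * h.onePointCongr * boundaryHomeo a)
    (tendsto_nhds_unique (hlimh.tendsto_apply (tendsto_const_nhds (x := OnePoint.infty)))
      tendsto_const_nhds)
  rw [← hh'] at hlimh
  have hH' := hH.isometry_comp b a
  exact ⟨b.toEquiv * H * a.toEquiv, h', s, hs,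
    ⟨z, htame, s, hs, fun K hK => hlimH.tendstoUniformlyOn hH'.1.continuous hK,
      hlimh.sphereTendstoUniformly h'.onePointCongr.continuous⟩, hh' ▸ hH',
    hh' ▸ pairEquivalent_isometry_comp H h.onePointCongr b a, hlimh.of_onePoint_map⟩

/-! ### The length-area method -/

open MeasureTheory

theorem sum_measureReal_le {α ι : Type*} [MeasurableSpace α] {μ : Measure α} {s : Finset ι}
    {f : ι → Set α} {S : Set α} (hd : (s : Set ι).PairwiseDisjoint f)
    (hm : ∀ i ∈ s, MeasurableSet (f i)) (hS : ∀ i ∈ s, f i ⊆ S) (hfin : μ S ≠ ⊤) :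
    ∑ i ∈ s, μ.real (f i) ≤ μ.real S := by
  rw [← measureReal_biUnion_finset hd hm fun i hi => measure_ne_top_of_subset (hS i hi) hfin]
  exact measureReal_mono (iUnion₂_subset hS) hfin

section LengthArea

variable {X : Type*} [PseudoMetricSpace X]

/-- The hypothesis of the length-area argument: the squared distance between the images of the
endpoints of the lower side of a square is at most the `μ`-measure of the square. A constant factor
is absorbed in `μ`. -/
def IsControlledOnSquares (μ : Measure (ℝ × ℝ)) (f : ℝ × ℝ → X) : Prop :=
  ∀ x y δ : ℝ, 0 < δ → dist (f (x, y)) (f (x + δ, y)) ^ 2 ≤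
    μ.real (Ioo x (x + δ) ×ˢ Ioo y (y + δ))

variable {μ : Measure (ℝ × ℝ)} [IsFiniteMeasureOnCompacts μ] {f : ℝ × ℝ → X}

theorem measure_Ioo_prod_Ioo_ne_top (a b c d : ℝ) : μ (Ioo a b ×ˢ Ioo c d) ≠ ⊤ :=
  ((Metric.isBounded_Ioo a b).prod (Metric.isBounded_Ioo c d)).measure_lt_top.ne

theorem measurableSet_Ioo_prod_Ioo (a b c d : ℝ) : MeasurableSet (Ioo a b ×ˢ Ioo c d) :=
  measurableSet_Ioo.prod measurableSet_Ioo

namespace IsControlledOnSquares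

theorem sq_dist_le_natCast_mul (hf : IsControlledOnSquares μ f) {a y δ η : ℝ} (hδ : 0 < δ)
    (hδη : δ ≤ η) (n : ℕ) : dist (f (a, y)) (f (a + n * δ, y)) ^ 2 ≤
      n * μ.real (Ioo a (a + n * δ) ×ˢ Ioo y (y + η)) := by
  let t (j : ℕ) : ℝ := a + j * δ
  have ht : Monotone t := fun i j hij => by
    simp only [t]
    gcongr
  have ht0 : t 0 = a := by simp [t]
  have ht_succ (j : ℕ) : t (j + 1) = t j + δ := by
    simp only [t]
    push_cast
    ring
  calc dist (f (a, y)) (f (t n, y)) ^ 2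
      ≤ (∑ j ∈ Finset.range n, dist (f (t j, y)) (f (t (j + 1), y))) ^ 2 := by
        gcongr
        conv_lhs => rw [← ht0]
        exact dist_le_range_sum_dist (fun j => f (t j, y)) n
    _ ≤ n * ∑ j ∈ Finset.range n, dist (f (t j, y)) (f (t (j + 1), y)) ^ 2 := by
        simpa only [Finset.card_range] using
          sq_sum_le_card_mul_sum_sq (s := Finset.range n)
            (f := fun j => dist (f (t j, y)) (f (t (j + 1), y)))
    _ ≤ n * ∑ j ∈ Finset.range n, μ.real (Ioo (t j) (t (j + 1)) ×ˢ Ioo y (y + η)) := by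
        gcongr with j
        rw [ht_succ]
        refine (hf _ _ _ hδ).trans (measureReal_mono ?_ (measure_Ioo_prod_Ioo_ne_top _ _ _ _))
        gcongr
    _ ≤ n * μ.real (Ioo a (t n) ×ˢ Ioo y (y + η)) := by
        gcongr
        refine sum_measureReal_le (fun i _ j _ hij => ?_)
          (fun _ _ => measurableSet_Ioo_prod_Ioo _ _ _ _) (fun j hj => ?_)
          (measure_Ioo_prod_Ioo_ne_top _ _ _ _)
        · exact (ht.pairwise_disjoint_on_Ioo_succ hij).set_prod_left _ _
        · refine prod_mono (Ioo_subset_Ioo ?_ ?_) subset_rfl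
          · rw [← ht0]
            exact ht j.zero_le
          · exact ht (Finset.mem_range.1 hj)

theorem sq_dist_le (hf : IsControlledOnSquares μ f) {a b y η : ℝ} (hab : a ≤ b) (hη : 0 < η) :
    dist (f (a, y)) (f (b, y)) ^ 2 ≤
      ((b - a) / η + 1) * μ.real (Ioo a b ×ˢ Ioo y (y + η)) := by
  obtain rfl | hab := hab.eq_or_lt
  · rw [dist_self, zero_pow two_ne_zero]
    positivity
  have h_ratio : 0 < (b - a) / η := div_pos (sub_pos.2 hab) hη
  let n := ⌈(b - a) / η⌉₊
  have hn : (0 : ℝ) < n := Nat.cast_pos.2 (Nat.ceil_pos.2 h_ratio)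
  have h_step : (b - a) / n ≤ η := by
    rw [div_le_iff₀ hn, ← div_le_iff₀' hη]
    exact Nat.le_ceil _
  have h := hf.sq_dist_le_natCast_mul (a := a) (y := y) (div_pos (sub_pos.2 hab) hn) h_step n
  rw [mul_div_cancel₀ _ hn.ne', add_sub_cancel] at h
  refine h.trans ?_
  gcongr
  exact (Nat.ceil_lt_add_one h_ratio.le).le

theorem sq_sum_dist_le (hf : IsControlledOnSquares μ f) {ι : Type*} {s : Finset ι} {a b : ι → ℝ}
    (hab : ∀ i ∈ s, a i ≤ b i) (hd : (s : Set ι).PairwiseDisjoint fun i => Ioo (a i) (b i))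
    {c d : ℝ} (hcd : ∀ i ∈ s, Ioo (a i) (b i) ⊆ Ioo c d) (y : ℝ) {η : ℝ} (hη : 0 < η) :
    (∑ i ∈ s, dist (f (a i, y)) (f (b i, y))) ^ 2 ≤
      ((∑ i ∈ s, (b i - a i)) / η + s.card) * μ.real (Ioo c d ×ˢ Ioo y (y + η)) := by
  have h_nonneg : ∀ i ∈ s, 0 ≤ (b i - a i) / η + 1 := fun i hi => by
    have := sub_nonneg.2 (hab i hi)
    positivity
  have h_sum : ∑ i ∈ s, ((b i - a i) / η + 1) = (∑ i ∈ s, (b i - a i)) / η + s.card := by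
    rw [Finset.sum_add_distrib, Finset.sum_const, nsmul_one, Finset.sum_div]
  rw [← h_sum]
  calc (∑ i ∈ s, dist (f (a i, y)) (f (b i, y))) ^ 2
      ≤ (∑ i ∈ s, ((b i - a i) / η + 1)) *
          ∑ i ∈ s, μ.real (Ioo (a i) (b i) ×ˢ Ioo y (y + η)) :=
        Finset.sum_sq_le_sum_mul_sum_of_sq_le_mul s h_nonneg (fun _ _ => measureReal_nonneg)
          fun i hi => hf.sq_dist_le (hab i hi) hη
    _ ≤ _ := by
        refine mul_le_mul_of_nonneg_left (sum_measureReal_le (fun i hi j hj hij => ?_)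
          (fun _ _ => measurableSet_Ioo_prod_Ioo _ _ _ _)
          (fun i hi => prod_mono (hcd i hi) subset_rfl) (measure_Ioo_prod_Ioo_ne_top _ _ _ _))
          (Finset.sum_nonneg h_nonneg)
        exact (hd hi hj hij).set_prod_left _ _

theorem sq_sum_dist_le_of_eventually (hf : IsControlledOnSquares μ f) {ι : Type*} {s : Finset ι}
    {a b : ι → ℝ} (hab : ∀ i ∈ s, a i ≤ b i)
    (hd : (s : Set ι).PairwiseDisjoint fun i => Ioo (a i) (b i)) {c d : ℝ}
    (hcd : ∀ i ∈ s, Ioo (a i) (b i) ⊆ Ioo c d) {y M : ℝ}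
    (hM : ∀ᶠ η in 𝓝[>] (0 : ℝ), μ.real (Ioo c d ×ˢ Ioo y (y + η)) ≤ M * η) :
    (∑ i ∈ s, dist (f (a i, y)) (f (b i, y))) ^ 2 ≤ (∑ i ∈ s, (b i - a i)) * M := by
  have h_cont : Continuous fun η : ℝ => (∑ i ∈ s, (b i - a i) + s.card * η) * M := by fun_prop
  have h_lim := (h_cont.tendsto 0).mono_left (nhdsWithin_le_nhds (s := Ioi 0))
  rw [mul_zero, add_zero] at h_lim
  refine ge_of_tendsto h_lim ?_
  filter_upwards [hM, self_mem_nhdsWithin] with η hη hη0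
  have h_len : 0 ≤ ∑ i ∈ s, (b i - a i) := Finset.sum_nonneg fun i hi => sub_nonneg.2 (hab i hi)
  have hη0 : 0 < η := hη0
  calc (∑ i ∈ s, dist (f (a i, y)) (f (b i, y))) ^ 2
      ≤ ((∑ i ∈ s, (b i - a i)) / η + s.card) * μ.real (Ioo c d ×ˢ Ioo y (y + η)) :=
        hf.sq_sum_dist_le hab hd hcd y hη0
    _ ≤ ((∑ i ∈ s, (b i - a i)) / η + s.card) * (M * η) := by gcongr
    _ = (∑ i ∈ s, (b i - a i) + s.card * η) * M := by field_simp

theorem absolutelyContinuousOnInterval (hf : IsControlledOnSquares μ f) {a b y M : ℝ}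
    (hM : ∀ᶠ η in 𝓝[>] (0 : ℝ), μ.real (uIoo a b ×ˢ Ioo y (y + η)) ≤ M * η) :
    AbsolutelyContinuousOnInterval (fun x => f (x, y)) a b := by
  have h_bound {n : ℕ} {I : ℕ → ℝ × ℝ}
      (hI : (n, I) ∈ AbsolutelyContinuousOnInterval.disjWithin a b) :
      (∑ i ∈ Finset.range n, dist (f ((I i).1, y)) (f ((I i).2, y))) ^ 2 ≤
        (∑ i ∈ Finset.range n, dist (I i).1 (I i).2) * M := by
    have h_min_max (i : ℕ) : dist (f ((I i).1, y)) (f ((I i).2, y)) =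
        dist (f (min (I i).1 (I i).2, y)) (f (max (I i).1 (I i).2, y)) := by
      obtain h | h := le_total (I i).1 (I i).2
      · rw [min_eq_left h, max_eq_right h]
      · rw [min_eq_right h, max_eq_left h, dist_comm]
    simp only [h_min_max, Real.dist_eq, ← max_sub_min_eq_abs']
    refine hf.sq_sum_dist_le_of_eventually (fun _ _ => min_le_max) (fun i hi j hj hij =>
      (hI.2 hi hj hij).mono Ioo_subset_Ioc_self Ioo_subset_Ioc_self) (fun i hi => ?_) hM
    obtain ⟨h₁, h₂⟩ := hI.1 i hi
    exact Ioo_subset_Ioo (le_min h₁.1 h₂.1) (max_le h₁.2 h₂.2)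
  rw [absolutelyContinuousOnInterval_iff]
  intro ε hε
  refine ⟨ε ^ 2 / (|M| + 1), by positivity, fun I hI h_len => ?_⟩
  rw [lt_div_iff₀ (by positivity)] at h_len
  have := Finset.sum_nonneg fun i (_ : i ∈ Finset.range I.1) =>
    dist_nonneg (x := (I.2 i).1) (y := (I.2 i).2)
  refine lt_of_pow_lt_pow_left₀ 2 hε.le ((h_bound hI).trans_lt (lt_of_le_of_lt ?_ h_len))
  gcongr
  linarith [le_abs_self M]

end IsControlledOnSquares

/-- The measure of the strip over `Ioo a b` up to height `y` is monotone in `y`, hence almost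
everywhere differentiable. -/
theorem ae_exists_eventually_measureReal_strip_le (μ : Measure (ℝ × ℝ))
    [IsFiniteMeasureOnCompacts μ] (a b : ℝ) :
    ∀ᵐ y : ℝ, ∃ M : ℝ, ∀ᶠ η in 𝓝[>] (0 : ℝ), μ.real (Ioo a b ×ˢ Ioo y (y + η)) ≤ M * η := by
  let A (n : ℕ) (y : ℝ) : ℝ := μ.real (Ioo a b ×ˢ Ioo (-n : ℝ) y)
  have hA (n : ℕ) : Monotone (A n) := fun y y' h =>
    measureReal_mono (prod_mono subset_rfl (Ioo_subset_Ioo le_rfl h))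
      (measure_Ioo_prod_Ioo_ne_top _ _ _ _)
  filter_upwards [ae_all_iff.2 fun n => (hA n).ae_differentiableAt] with y hy
  obtain ⟨n, hn⟩ := exists_nat_gt (-y)
  refine ⟨deriv (A n) y + 1, ?_⟩
  filter_upwards [(hy n).hasDerivAt.tendsto_slope_zero_right.eventually_lt_const (lt_add_one _),
    self_mem_nhdsWithin] with η h_slope hη
  have hη : 0 < η := hη
  rw [smul_eq_mul, inv_mul_lt_iff₀ hη, mul_comm] at h_slope
  refine le_trans ?_ h_slope.le
  rw [le_sub_iff_add_le, ← measureReal_union _ (measurableSet_Ioo_prod_Ioo _ _ _ _)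
    (measure_Ioo_prod_Ioo_ne_top _ _ _ _) (measure_Ioo_prod_Ioo_ne_top _ _ _ _)]
  · refine measureReal_mono (union_subset ?_ ?_) (measure_Ioo_prod_Ioo_ne_top _ _ _ _)
    · exact prod_mono subset_rfl (Ioo_subset_Ioo (neg_lt.1 hn).le le_rfl)
    · exact prod_mono subset_rfl (Ioo_subset_Ioo le_rfl (le_add_of_nonneg_right hη.le))
  · exact disjoint_left.2 fun p hp hp' => (hp.2.1.trans hp'.2.2).false

theorem IsControlledOnSquares.ae_absolutelyContinuousOnInterval (hf : IsControlledOnSquares μ f)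
    (a b : ℝ) : ∀ᵐ y : ℝ, AbsolutelyContinuousOnInterval (fun x => f (x, y)) a b := by
  filter_upwards [ae_exists_eventually_measureReal_strip_le μ (a ⊓ b) (a ⊔ b)] with y ⟨M, hM⟩
  exact hf.absolutelyContinuousOnInterval hM

end LengthArea

theorem frequently_ae_hasDerivAt_ne_zero {E : Type*} [NormedAddCommGroup E] [NormedSpace ℝ E]
    [FiniteDimensional ℝ E] {f : ℝ → E} {a b : ℝ} (hf : AbsolutelyContinuousOnInterval f a b)
    (hab : f a ≠ f b) : ∃ᵐ x : ℝ, ∃ w ≠ 0, HasDerivAt f w x := by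
  intro h
  obtain ⟨c, hc⟩ := hf.const_of_ae_hasDerivAt_zero (by
    filter_upwards [h, hf.boundedVariationOn.ae_differentiableAt_of_mem_uIcc] with x hx hdiff hmem
    have hderiv := (hdiff hmem).hasDerivAt
    have h_zero : deriv f x = 0 := by
      by_contra hw
      exact hx ⟨_, hw, hderiv⟩
    rwa [h_zero] at hderiv)
  exact hab ((hc a left_mem_uIcc).trans (hc b right_mem_uIcc).symm)

theorem IsControlledOnSquares.frequently_ae_hasLineDerivAt_ne_zero {E : Type*}
    [NormedAddCommGroup E] [NormedSpace ℝ E] [FiniteDimensional ℝ E] {μ : Measure (ℝ × ℝ)}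
    [IsFiniteMeasureOnCompacts μ] {f : ℝ × ℝ → E} (hf : IsControlledOnSquares μ f)
    (hinj : Function.Injective f) : ∃ᵐ p : ℝ × ℝ, ∃ w ≠ 0, HasLineDerivAt ℝ f w p (1, 0) := by
  intro h
  have h_fubini := Measure.ae_ae_of_ae_prod
    (Measure.measurePreserving_swap.quasiMeasurePreserving.ae h)
  obtain ⟨y, hy, hac⟩ := (h_fubini.and (hf.ae_absolutelyContinuousOnInterval 0 1)).exists
  refine frequently_ae_hasDerivAt_ne_zero hac (fun h01 => by simpa using hinj h01) ?_
  filter_upwards [hy] with x hx ⟨w, hw, hderiv⟩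
  refine hx ⟨w, hw, ?_⟩
  have h_shift := HasDerivAt.comp_const_add x 0 ((add_zero x).symm ▸ hderiv)
  simpa [HasLineDerivAt] using h_shift

theorem IsQuasisymmetric.ball_subset_image_ball {X Y : Type*} [MetricSpace X] [MetricSpace Y]
    {η : NNReal → NNReal} {f : X → Y} (hf : IsQuasisymmetric η f) (hsurj : Function.Surjective f)
    {x p : X} {r : ℝ} (hp : dist p x ≤ r) :
    Metric.ball (f x) (dist (f p) (f x) / η 1) ⊆ f '' Metric.ball x r := by
  intro q hq
  obtain ⟨z, rfl⟩ := hsurj q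
  refine mem_image_of_mem f ?_
  by_contra hz
  rw [Metric.mem_ball, not_lt] at hz
  refine (Metric.mem_ball.1 hq).not_ge (div_le_of_le_mul₀ (η 1).coe_nonneg dist_nonneg ?_)
  rw [mul_comm]
  exact hf 1 x p z (by simpa using hp.trans hz)

theorem isFiniteMeasureOnCompacts_map_homeomorph {X Y : Type*} [TopologicalSpace X]
    [MeasurableSpace X] [BorelSpace X] [TopologicalSpace Y] [MeasurableSpace Y] [BorelSpace Y]
    (μ : Measure X) [IsFiniteMeasureOnCompacts μ] (e : X ≃ₜ Y) :
    IsFiniteMeasureOnCompacts (μ.map e) where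
  lt_top_of_isCompact K hK := by
    rw [e.measurableEmbedding.map_apply]
    exact (e.isCompact_preimage.2 hK).measure_lt_top

theorem IsQuasisymmetric.sq_dist_le_measureReal_ball {X : Type*} [MetricSpace X] [ProperSpace X]
    [MeasurableSpace X] [BorelSpace X] {η : NNReal → NNReal} {f : X ≃ₜ ℂ}
    (hf : IsQuasisymmetric η f) {x p : X} {r : ℝ} (hp : dist p x ≤ r) :
    dist (f p) (f x) ^ 2 ≤ η 1 ^ 2 * (volume.map f.symm).real (Metric.ball x r) := by
  have := isFiniteMeasureOnCompacts_map_homeomorph volume f.symm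
  obtain hη | hη := eq_zero_or_pos (η 1)
  · have h := hf 1 x p p (by simp)
    rw [hη, NNReal.coe_zero, zero_mul] at h
    rw [le_antisymm h dist_nonneg, zero_pow two_ne_zero]
    positivity
  have : (0 : ℝ) < η 1 := hη
  rw [← div_le_iff₀' (by positivity), ← div_pow, measureReal_def,
    ← ENNReal.ofReal_le_iff_le_toReal measure_ball_lt_top.ne]
  calc ENNReal.ofReal ((dist (f p) (f x) / η 1) ^ 2)
      ≤ volume (Metric.ball (f x) (dist (f p) (f x) / η 1)) := by
        rw [Complex.volume_ball, ENNReal.ofReal_pow (by positivity)]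
        refine le_mul_of_one_le_right' ?_
        exact_mod_cast one_le_two.trans Real.two_le_pi
    _ ≤ volume (f '' Metric.ball x r) :=
        measure_mono (hf.ball_subset_image_ball f.surjective hp)
    _ = volume.map f.symm (Metric.ball x r) := by
        rw [f.image_eq_preimage_symm,
          Measure.map_apply f.symm.continuous.measurable measurableSet_ball]

theorem IsQuasisymmetric.isControlledOnSquares {η : NNReal → NNReal} {f : ℝ × ℝ ≃ₜ ℂ}
    (hf : IsQuasisymmetric η f) :
    IsControlledOnSquares ((4 * η 1 ^ 2) • volume.map f.symm) f := by
  intro x y δ hδ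
  let c : ℝ × ℝ := (x + δ / 2, y + δ / 2)
  have h_square : Ioo x (x + δ) ×ˢ Ioo y (y + δ) = Metric.ball c (δ / 2) := by
    rw [← ball_prod_same, Real.ball_eq_Ioo, Real.ball_eq_Ioo]
    congr 2 <;> ring
  have h_left : dist (x, y) c ≤ δ / 2 := by
    simp [c, Prod.dist_eq, abs_of_pos hδ]
  have h_right : dist (x + δ, y) c ≤ δ / 2 := by
    simp [c, Prod.dist_eq, Real.dist_eq, sub_half, abs_div, abs_of_pos hδ]
  rw [h_square, measureReal_nnreal_smul_apply]
  push_cast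
  calc dist (f (x, y)) (f (x + δ, y)) ^ 2
      ≤ (dist (f (x, y)) (f c) + dist (f (x + δ, y)) (f c)) ^ 2 := by
        gcongr
        exact dist_triangle_right _ _ _
    _ ≤ 2 * (dist (f (x, y)) (f c) ^ 2 + dist (f (x + δ, y)) (f c) ^ 2) := add_sq_le
    _ ≤ 4 * (η 1 : ℝ) ^ 2 * (volume.map f.symm).real (Metric.ball c (δ / 2)) := by
        linarith [hf.sq_dist_le_measureReal_ball h_left, hf.sq_dist_le_measureReal_ball h_right]

theorem IsQuasisymmetric.frequently_ae_hasLineDerivAt_ne_zero {η : NNReal → NNReal} {h : ℂ ≃ₜ ℂ}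
    (hh : IsQuasisymmetric η h) {v : ℂ} (hv : v ≠ 0) :
    ∃ᵐ z : ℂ, ∃ w ≠ 0, HasLineDerivAt ℝ h w z v := by
  let L : (ℝ × ℝ) ≃L[ℝ] ℂ := Complex.equivRealProdCLM.symm.trans
    (ContinuousLinearEquiv.smulLeft (Units.mk0 v hv))
  have hL : L (1, 0) = v := by
    simp [L, Complex.equivRealProdCLM_symm_apply, Units.smul_def]
  have hf : IsQuasisymmetric _ (L.toHomeomorph.trans h) := hh.comp L.lipschitz L.antilipschitz
  have := isFiniteMeasureOnCompacts_map_homeomorph volume (L.toHomeomorph.trans h).symm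
  intro h_ae
  refine hf.isControlledOnSquares.frequently_ae_hasLineDerivAt_ne_zero
    (L.toHomeomorph.trans h).injective ?_
  have := L.isAddHaarMeasure_map volume
  have hac := Measure.absolutelyContinuous_isAddHaarMeasure (volume.map L) volume
  filter_upwards [ae_of_ae_map L.continuous.aemeasurable (hac.ae_le h_ae)] with p hp ⟨w, hw, hd⟩
  have h_line (t : ℝ) : L.toHomeomorph.trans h (p + t • (1, 0)) = h (L p + t • v) := by
    change h (L _) = _
    rw [map_add, map_smul, hL]
  refine hp ⟨w, hw, ?_⟩
  simpa only [HasLineDerivAt, h_line] using hd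

/-! ### Zooming at density points -/

section DensityPoint

variable {E F : Type*} [NormedAddCommGroup E] [NormedSpace ℝ E] [NormedAddCommGroup F]
  [NormedSpace ℝ F]

theorem exists_tendsto_forall_add_smul_mem [FiniteDimensional ℝ E] [MeasurableSpace E]
    [BorelSpace E] (μ : Measure E) [μ.IsAddHaarMeasure] {S : Set E} {z : E} (hz : z ∈ S)
    (hdens : Tendsto (fun r => μ (S ∩ Metric.closedBall z r) / μ (Metric.closedBall z r)) (𝓝[>] 0)
      (𝓝 1))
    {ι : Type*} {l : Filter ι} {r : ι → ℝ} (hr_pos : ∀ i, 0 < r i) (hr : Tendsto r l (𝓝 0))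
    (u : E) : ∃ x : ι → E, Tendsto x l (𝓝 u) ∧ ∀ i, z + r i • x i ∈ S := by
  let T (i : ι) : Set E := {x | z + r i • x ∈ S}
  have hT_nonempty (i : ι) : (T i).Nonempty := ⟨0, by simpa [T] using hz⟩
  have h_infDist : Tendsto (fun i => Metric.infDist u (T i)) l (𝓝 0) := by
    refine tendsto_order.2 ⟨fun a ha => Eventually.of_forall fun i =>
      ha.trans_le Metric.infDist_nonneg, fun a ha => ?_⟩
    have h_meet := Measure.eventually_nonempty_inter_smul_of_density_one μ S z hdens
      (Metric.ball u a) measurableSet_ball (Metric.measure_ball_pos _ _ ha).ne'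
    filter_upwards [(tendsto_nhdsWithin_iff.2 ⟨hr, Eventually.of_forall hr_pos⟩).eventually h_meet]
      with i ⟨y, hyS, hy⟩
    rw [singleton_add] at hy
    obtain ⟨_, ⟨x, hx, rfl⟩, rfl⟩ := hy
    exact (Metric.infDist_le_dist_of_mem (s := T i) hyS).trans_lt (Metric.mem_ball'.1 hx)
  choose x hxT hx using fun i =>
    (Metric.infDist_lt_iff (hT_nonempty i)).1 (lt_add_of_pos_right _ (hr_pos i))
  refine ⟨x, tendsto_iff_dist_tendsto_zero.2 ?_, hxT⟩
  refine squeeze_zero (fun _ => dist_nonneg) (fun i => ?_) (by simpa using h_infDist.add hr)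
  rw [dist_comm]
  exact (hx i).le

/-- The points from which the increments of `f` in the direction `v` up to scale `δ` are linear with
slope `q`, up to a relative error `ε`. -/
def nearlyLinearSet (f : E → F) (v : E) (q : F) (ε δ : ℝ) : Set E :=
  {z | ∀ s : ℝ, |s| < δ → ‖f (z + s • v) - f z - s • q‖ ≤ ε * |s|}

theorem exists_mem_nearlyLinearSet {f : E → F} {v z : E} {w q : F} {ε : ℝ}
    (hf : HasLineDerivAt ℝ f w z v) (hq : ‖w - q‖ < ε) :
    ∃ δ > 0, z ∈ nearlyLinearSet f v q ε δ := by
  obtain ⟨δ, hδ, h⟩ := Metric.eventually_nhds_iff.1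
    ((hasDerivAt_iff_isLittleO_nhds_zero.1 hf).def (sub_pos.2 hq))
  refine ⟨δ, hδ, fun s hs => ?_⟩
  have h_deriv : ‖f (z + s • v) - f z - s • w‖ ≤ (ε - ‖w - q‖) * |s| := by
    simpa using h (y := s) (by simpa using hs)
  calc ‖f (z + s • v) - f z - s • q‖
      = ‖(f (z + s • v) - f z - s • w) + s • (w - q)‖ := by
        rw [smul_sub, sub_add_sub_cancel]
    _ ≤ (ε - ‖w - q‖) * |s| + |s| * ‖w - q‖ := by
        refine norm_add_le_of_le h_deriv ?_
        rw [norm_smul, Real.norm_eq_abs]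
    _ = ε * |s| := by ring

theorem norm_inv_smul_sub_le_of_mem_nearlyLinearSet {f : E → F} {v z x : E} {w q : F} {ε δ r s : ℝ}
    (hx : z + r • x ∈ nearlyLinearSet f v q ε δ) (hr : 0 < r) (hs : r * |s| < δ)
    (hq : ‖w - q‖ ≤ ε) :
    ‖r⁻¹ • (f (z + r • (x + s • v)) - f (z + r • x)) - s • w‖ ≤ 2 * ε * |s| := by
  have h_abs : |r * s| = r * |s| := by rw [abs_mul, abs_of_pos hr]
  have h := hx (r * s) (h_abs ▸ hs)
  rw [h_abs, add_assoc, mul_smul r s v, ← smul_add, mul_smul r s q] at h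
  set D := f (z + r • (x + s • v)) - f (z + r • x)
  calc ‖r⁻¹ • D - s • w‖ = ‖r⁻¹ • (D - r • s • q) - s • (w - q)‖ := by
        rw [smul_sub r⁻¹ D, inv_smul_smul₀ hr.ne', smul_sub s, sub_sub, add_sub_cancel]
    _ ≤ r⁻¹ * (ε * (r * |s|)) + |s| * ε := by
        refine norm_sub_le_of_le ?_ ?_
        · rw [norm_smul, Real.norm_of_nonneg (inv_nonneg.2 hr.le)]
          gcongr
        · rw [norm_smul, Real.norm_eq_abs]
          gcongr
    _ = 2 * ε * |s| := by
        field_simp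
        ring

/-- Fix countably many slopes and scales; almost every point is a density point of each of the
corresponding nearly linear sets that contain it. -/
theorem ae_forall_hasLineDerivAt_exists_tendsto [FiniteDimensional ℝ E] [MeasurableSpace E]
    [BorelSpace E] [TopologicalSpace.SeparableSpace F] (μ : Measure E) [μ.IsAddHaarMeasure]
    (f : E → F) (v : E) :
    ∀ᵐ z ∂μ, ∀ w, HasLineDerivAt ℝ f w z v → ∀ r : ℕ → ℝ, (∀ n, 0 < r n) →
      Tendsto r atTop (𝓝 0) → ∀ (u : E) (s : ℝ), ∀ ε > 0, ∃ x : ℕ → E, Tendsto x atTop (𝓝 u) ∧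
        ∀ᶠ n in atTop,
          ‖(r n)⁻¹ • (f (z + r n • (x n + s • v)) - f (z + r n • x n)) - s • w‖ ≤ ε := by
  let S (m l j : ℕ) : Set E :=
    nearlyLinearSet f v (TopologicalSpace.denseSeq F j) (1 / (m + 1)) (1 / (l + 1))
  have h_density : ∀ᵐ z ∂μ, ∀ m l j, z ∈ S m l j → Tendsto
      (fun r => μ (S m l j ∩ Metric.closedBall z r) / μ (Metric.closedBall z r))
      (𝓝[>] 0) (𝓝 1) := by
    simp only [ae_all_iff]
    exact fun m l j => ae_imp_of_ae_restrict (Besicovitch.ae_tendsto_measure_inter_div μ _)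
  filter_upwards [h_density] with z hz w hw r hr_pos hr u s ε hε
  obtain ⟨m, hm⟩ := exists_nat_one_div_lt (show 0 < ε / (2 * (|s| + 1)) by positivity)
  obtain ⟨j, hj⟩ := (TopologicalSpace.denseRange_denseSeq F).exists_dist_lt w
    (show (0 : ℝ) < 1 / (m + 1) by positivity)
  rw [dist_eq_norm] at hj
  obtain ⟨δ, hδ, hδ_mem⟩ := exists_mem_nearlyLinearSet hw hj
  obtain ⟨l, hl⟩ := exists_nat_one_div_lt hδ
  have h_mem : z ∈ S m l j := fun t ht => hδ_mem t (ht.trans hl)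
  obtain ⟨x, hx, hxS⟩ := exists_tendsto_forall_add_smul_mem μ h_mem (hz m l j h_mem) hr_pos hr u
  refine ⟨x, hx, ?_⟩
  have h_scale : Tendsto (fun n => r n * |s|) atTop (𝓝 0) := by simpa using hr.mul_const |s|
  filter_upwards [h_scale.eventually_lt_const (show (0 : ℝ) < 1 / (l + 1) by positivity)] with n hn
  refine (norm_inv_smul_sub_le_of_mem_nearlyLinearSet (hxS n) (hr_pos n) hn hj.le).trans ?_
  rw [lt_div_iff₀ (by positivity)] at hm
  have : (0 : ℝ) < 1 / (m + 1) := by positivity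
  linarith

end DensityPoint

theorem TendstoContinuously.map_add_eq {ι E F : Type*} [TopologicalSpace E] [Add E]
    [ContinuousAdd E] [NormedAddCommGroup F] {l : Filter ι} [l.NeBot] {Φ : ι → E → F} {φ : E → F}
    (hΦ : TendstoContinuously Φ φ l) {p a : E} {b : F}
    (h : ∀ ε > 0, ∃ x : ι → E, Tendsto x l (𝓝 p) ∧
      ∀ᶠ i in l, ‖Φ i (x i + a) - Φ i (x i) - b‖ ≤ ε) : φ (p + a) = φ p + b := by
  rw [← sub_eq_iff_eq_add', ← sub_eq_zero, ← norm_le_zero_iff]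
  refine le_of_forall_pos_le_add fun ε hε => ?_
  obtain ⟨x, hx, hxε⟩ := h ε hε
  rw [zero_add]
  exact le_of_tendsto (((hΦ.tendsto_apply (hx.add_const a)).sub
    (hΦ.tendsto_apply hx)).sub_const b).norm hxε

theorem isGoodDirection_of_forall {h : ℂ → ℂ} {v w : ℂ} (hv : v ≠ 0) (hw : w ≠ 0)
    (hh : ∀ (p : ℂ) (s : ℝ), h (p + s * v) = h p + s * w) : IsGoodDirection h v := by
  intro p
  refine ⟨⟨h p, w, hw, ?_⟩, ‖w‖ / ‖v‖, div_pos (norm_pos_iff.2 hw) (norm_pos_iff.2 hv), ?_⟩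
  · ext y
    constructor
    · rintro ⟨_, ⟨s, rfl⟩, rfl⟩
      exact ⟨s, hh p s⟩
    · rintro ⟨s, rfl⟩
      exact ⟨_, ⟨s, rfl⟩, hh p s⟩
  · rintro _ ⟨s, rfl⟩ _ ⟨s', rfl⟩
    have hv := norm_ne_zero_iff.2 hv
    rw [hh, hh, dist_add_left, dist_add_left, dist_eq_norm, dist_eq_norm, ← sub_mul, ← sub_mul,
      norm_mul, norm_mul]
    field_simp

theorem tendsto_zoomPlane_add {h : ℂ ≃ₜ ℂ} {z v w : ℂ} (hd : HasLineDerivAt ℝ h w z v) :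
    Tendsto (fun n : ℕ => zoomPlane h z n (z + v)) atTop (𝓝 (h z + w)) := by
  have h_scale : Tendsto (fun n : ℕ => 1 / ((n : ℝ) + 1)) atTop (𝓝[>] 0) :=
    tendsto_nhdsWithin_iff.2 ⟨tendsto_one_div_add_atTop_nhds_zero_nat,
      Eventually.of_forall fun n => mem_Ioi.2 (one_div_pos.2 n.cast_add_one_pos)⟩
  rw [add_comm (h z)]
  refine ((hd.tendsto_slope_zero_right.comp h_scale).add_const (h z)).congr fun n => ?_
  simp [zoomPlane_eq]

theorem IsEquivariantPair.exists_zoomsTo_isGoodDirection {H : Equiv.Perm HypThree} {h : ℂ ≃ₜ ℂ}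
    (hH : IsEquivariantPair H h.onePointCongr) {v : ℂ} (hv : v ≠ 0) :
    ∃ (H' : Equiv.Perm HypThree) (h' : ℂ ≃ₜ ℂ), ZoomsTo H h H' h' ∧
      IsEquivariantPair H' h'.onePointCongr ∧
      PairEquivalent H h.onePointCongr H' h'.onePointCongr ∧ IsGoodDirection h' v := by
  obtain ⟨η, hη⟩ := hH.exists_isQuasisymmetric
  obtain ⟨z, ⟨w, hw, hd⟩, hz⟩ := ((hη.frequently_ae_hasLineDerivAt_ne_zero hv).and_eventually
    (ae_forall_hasLineDerivAt_exists_tendsto volume h v)).exists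
  obtain ⟨H', h', s, hs, hZ, hE, hP, hlim⟩ := hH.exists_zoomsTo hv hw (tendsto_zoomPlane_add hd)
  refine ⟨H', h', hZ, hE, hP, isGoodDirection_of_forall hv hw fun p t =>
    hlim.map_add_eq fun ε hε => ?_⟩
  obtain ⟨x, hx, hxε⟩ := hz w hd (fun n => 1 / (n + 1)) (fun n => one_div_pos.2 n.cast_add_one_pos)
    tendsto_one_div_add_atTop_nhds_zero_nat (p - z) t ε hε
  refine ⟨fun n => z + x (s n), ?_, ?_⟩
  · simpa using (hx.comp hs.tendsto_atTop).const_add z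
  · filter_upwards [hs.tendsto_atTop.eventually hxε] with n hn
    rw [zoomPlane_eq, zoomPlane_eq, add_sub_add_right_eq_sub, ← smul_sub, sub_sub_sub_cancel_right,
      add_assoc, add_sub_cancel_left, add_sub_cancel_left]
    simpa using hn

theorem corollary7 (H : Equiv.Perm HypThree) (h : ℂ ≃ₜ ℂ)
    (hH : IsEquivariantPair H h.onePointCongr) (v : ℂ) (hv : v ≠ 0) :
    ∃ (H' H'' : Equiv.Perm HypThree) (h' h'' : ℂ ≃ₜ ℂ),
      ZoomsTo H h H' h' ∧ ZoomsTo H' h' H'' h'' ∧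
      IsEquivariantPair H' h'.onePointCongr ∧
      PairEquivalent H h.onePointCongr H' h'.onePointCongr ∧
      IsEquivariantPair H'' h''.onePointCongr ∧
      PairEquivalent H h.onePointCongr H'' h''.onePointCongr ∧
      IsGoodDirection h'' v := by
  obtain ⟨H', h', hZ, hE, hP, -⟩ := hH.exists_zoomsTo_isGoodDirection hv
  obtain ⟨H'', h'', hZ', hE', hP', hG⟩ := hE.exists_zoomsTo_isGoodDirection hv
  exact ⟨H', H'', h', h'', hZ, hZ', hE, hP, hE', hP.trans hP', hG⟩
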